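/- Let $t_0>0$, let $p,q:\mathbb{R}\to\mathbb{R}$ be continuous $t_0$-periodic functions with $p>0$, and consider the equation $$-(p\,h')'+q\,h=\lambda h \qquad (*)$$ for functions $h:\mathbb{R}\to\mathbb{R}$ such that $h$ and $p\,h'$ are differentiable. Let $\lambda_0\le\lambda_1\le\lambda_2\le\dots$ be the eigenvalues of $(*)$ with the periodic boundary condition $h(t+t_0)\equiv h(t)$, repeated according to multiplicity, and let $h_0,h_1,h_2,\dots$ be corresponding eigenfunctions, chosen so that for every real $\mu$ the functions $h_i$ with $\lambda_i=\mu$ form a basis of the eigenspace of $\mu$. Let $n\ge 1$ be an integer. (a) Suppose that $p$ and $q$ are $\frac{t_0}{2n}$-periodic. Then the $\frac{t_0}{2n}$-antiperiodic solutions of $(*)$ are $h_{2n(2k+1)-1}$ and $h_{2n(2k+1)}$, $k=0,1,2,\dots$, in the following sense: $h_i$ satisfies $h_i\left(t+\frac{t_0}{2n}\right)\equiv -h_i(t)$ if and only if $i=2n(2k+1)-1$ or $i=2n(2k+1)$ for some integer $k\ge 0$; and for every real $\mu$ the space of $\frac{t_0}{2n}$-antiperiodic solutions of $(*)$ with $\lambda=\mu$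 is spanned by those of the functions $h_{2n(2k+1)-1},h_{2n(2k+1)}$, $k\ge 0$, whose eigenvalue is $\mu$. (b) Suppose that $p$ and $q$ are $\frac{t_0}{n}$-periodic. Then, in the same sense, the $\frac{t_0}{n}$-periodic solutions of $(*)$ are $h_0$ and $h_{2nk-1},h_{2nk}$, $k=1,2,\dots$: the function $h_i$ is $\frac{t_0}{n}$-periodic if and only if $i=0$, or $i=2nk-1$ or $i=2nk$ for some integer $k\ge 1$; and for every real $\mu$ the space of $\frac{t_0}{n}$-periodic solutions of $(*)$ with $\lambda=\mu$ is spanned by those of the functions $h_0,h_{2nk-1},h_{2nk}$, $k\ge 1$, whose eigenvalue is $\mu$. -/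

import Mathlib

/-- `h` solves the Sturm–Liouville equation `-(p h')' + q h = μ h` on the whole real line:
`h` and the quasi-derivative `p h'` are differentiable and the equation holds pointwise. -/
def SLSolution (p q : ℝ → ℝ) (μ : ℝ) (h : ℝ → ℝ) : Prop :=
  Differentiable ℝ h ∧ Differentiable ℝ (fun t => p t * deriv h t) ∧
    ∀ t, -deriv (fun s => p s * deriv h s) t + q t * h t = μ * h t

/-- `lam 0 ≤ lam 1 ≤ lam 2 ≤ …` are all the eigenvalues, repeated according to multiplicity, and
`h 0, h 1, h 2, …` are corresponding eigenfunctions, of the Sturm–Liouville equation with the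
periodic boundary condition `h (t + T) = h t`: the functions `h i` with `lam i = μ` form a basis
of the eigenspace of `μ`, for every real `μ`. -/
structure IsPeriodicSLEnumeration (p q : ℝ → ℝ) (T : ℝ) (lam : ℕ → ℝ) (h : ℕ → ℝ → ℝ) :
    Prop where
  monotone : Monotone lam
  solution : ∀ i, SLSolution p q (lam i) (h i)
  periodic : ∀ i, Function.Periodic (h i) T
  linearIndependent : LinearIndependent ℝ h
  complete : ∀ (μ : ℝ) (v : ℝ → ℝ), SLSolution p q μ v → Function.Periodic v T →
    v ∈ Submodule.span ℝ (h '' {i | lam i = μ})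

/-- The indices `2n(2k+1) - 1` and `2n(2k+1)`, for `k = 0, 1, 2, …`. -/
def antiperiodicIndices (n : ℕ) : Set ℕ :=
  {i | ∃ k : ℕ, i + 1 = 2 * n * (2 * k + 1) ∨ i = 2 * n * (2 * k + 1)}

/-- The index `0` and the indices `2nk - 1` and `2nk`, for `k = 1, 2, …`. -/
def periodicIndices (n : ℕ) : Set ℕ :=
  {i | i = 0 ∨ ∃ k : ℕ, 1 ≤ k ∧ (i + 1 = 2 * n * k ∨ i = 2 * n * k)}

/-! Write (h, p h') = r (sin θ, cos θ). The Prüfer angle θ satisfies a first-order equation not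
involving r, so θ(T) is defined for every initial angle α and every μ. It is increasing in α,
commutes with shifts of α by π, and is strictly increasing in μ. A nonzero solution is T-periodic
exactly when, over time T, its radius returns to its initial value and its angle gains 2k half-turns
with k an integer (`IsTurn`). Call k its winding number.

The index determines the winding number: h_i has winding number ⌈i/2⌉ (`winding_eq`). At an exact
turn the turn θ(T) - α is either minimal or maximal over all α (`forall_le_or_forall_ge_of_isTurn`).
Conversely, an extremal turn that is a whole number of half-turns forces the radius to return
(`radius_eq_one_of_le`, `radius_eq_one_of_ge`), hence gives a periodic solution when that number is
even. Since the turn is monotone in μ, each k ≥ 1 belongs to one eigenvalue where the minimal turn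
is 2k half-turns and one where the maximal turn is. Either they differ and are simple, or they
coincide and every solution is periodic, so k is taken by two indices. For k = 0 the maximal turn
cannot occur, which leaves the single index 0.

If the coefficients have period τ = T/N, the angle after time T is the N-th iterate of an increasing
map commuting with the shift by π. A turn by Nm half-turns in time T therefore comes from exactly m
half-turns in each period τ (`isTurn_mul_iff`), so translation by τ multiplies the solution by
(-1)^m. Hence h_i is τ-periodic or τ-antiperiodic according to an arithmetic condition on 2⌈i/2⌉. As
the winding number depends on the eigenvalue alone, the spanning statement follows too
(`mem_span_iff`). -/

open Set Filter Topology

/-! ### The Prüfer equation: Lipschitz estimate and global existence -/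

/-- The right-hand side of the Prüfer equation for the polar angle of `(p h', h)`. -/
noncomputable def pruferField (p q : ℝ → ℝ) (μ t x : ℝ) : ℝ :=
  Real.cos x ^ 2 / p t + (μ - q t) * Real.sin x ^ 2

/-- `θ` solves the Prüfer equation on the whole line. -/
def IsPruferAngle (p q : ℝ → ℝ) (μ : ℝ) (θ : ℝ → ℝ) : Prop :=
  ∀ t, HasDerivAt θ (pruferField p q μ t (θ t)) t

theorem Real.sinc_mul_self (x : ℝ) : Real.sinc x * x = Real.sin x := by
  rcases eq_or_ne x 0 with rfl | hx
  · simp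
  · rw [Real.sinc_of_ne_zero hx, div_mul_cancel₀ _ hx]

theorem Real.cos_sq_sub_cos_sq (x y : ℝ) :
    Real.cos y ^ 2 - Real.cos x ^ 2 = -(Real.sin (x + y) * Real.sin (y - x)) := by
  rw [Real.sin_add, Real.sin_sub]
  have h1 := Real.sin_sq_add_cos_sq x
  have h2 := Real.sin_sq_add_cos_sq y
  linear_combination Real.cos x ^ 2 * h2 - Real.cos y ^ 2 * h1

/-- Since sin² y - sin² x = sin (x + y) sin (y - x), the factor y - x can be split off with a
coefficient that stays continuous at y = x; this is the role of `Real.sinc`. Differences of angles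
thus obey scalar linear equations whose inhomogeneity has the sign of ν - μ. -/
theorem pruferField_sub (p q : ℝ → ℝ) (μ ν t x y : ℝ) :
    pruferField p q ν t y - pruferField p q μ t x =
      ((ν - q t - 1 / p t) * Real.sin (x + y) * Real.sinc (y - x)) * (y - x) +
        (ν - μ) * Real.sin x ^ 2 := by
  rw [mul_assoc _ (Real.sinc _), Real.sinc_mul_self]
  have h := Real.cos_sq_sub_cos_sq x y
  unfold pruferField
  have h1 := Real.sin_sq_add_cos_sq x
  have h2 := Real.sin_sq_add_cos_sq y
  have hs : Real.sin (x + y) * Real.sin (y - x) = Real.sin y ^ 2 - Real.sin x ^ 2 := by linarith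
  have hc : Real.cos y ^ 2 = 1 - Real.sin y ^ 2 := by linarith
  have hc' : Real.cos x ^ 2 = 1 - Real.sin x ^ 2 := by linarith
  rw [mul_assoc, hs, hc, hc']
  ring

theorem abs_pruferField_sub_le (p q : ℝ → ℝ) (μ ν t x y : ℝ) :
    |pruferField p q ν t y - pruferField p q μ t x| ≤
      |ν - q t - 1 / p t| * |y - x| + |ν - μ| := by
  rw [pruferField_sub]
  refine (abs_add_le _ _).trans (add_le_add ?_ ?_)
  · rw [abs_mul, abs_mul, abs_mul]
    have h1 : |Real.sin (x + y)| * |Real.sinc (y - x)| ≤ 1 :=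
      mul_le_one₀ (Real.abs_sin_le_one _) (abs_nonneg _) (Real.abs_sinc_le_one _)
    rw [mul_assoc |ν - q t - 1 / p t|]
    exact mul_le_mul_of_nonneg_right (mul_le_of_le_one_right (abs_nonneg _) h1) (abs_nonneg _)
  · rw [abs_mul, abs_of_nonneg (sq_nonneg (Real.sin x))]
    exact mul_le_of_le_one_right (abs_nonneg _) (Real.sin_sq_le_one x)

/-- On a bounded time interval the coefficients of the Prüfer equation are bounded. -/
theorem exists_bound_coeff {p q : ℝ → ℝ} (hp : Continuous p) (hq : Continuous q)
    (hpos : ∀ t, 0 < p t) (μ a b : ℝ) :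
    ∃ C : NNReal, ∀ t ∈ Icc a b, |μ - q t - 1 / p t| ≤ C ∧ |1 / p t| ≤ C := by
  have hp' : Continuous fun t => 1 / p t := continuous_const.div hp fun t => (hpos t).ne'
  obtain ⟨C, hC⟩ := (isCompact_Icc (a := a) (b := b)).exists_bound_of_continuousOn
    (((continuous_const.sub hq).sub hp').continuousOn (s := Icc a b) : ContinuousOn
      (fun t => μ - q t - 1 / p t) _)
  obtain ⟨D, hD⟩ := (isCompact_Icc (a := a) (b := b)).exists_bound_of_continuousOn
    (hp'.continuousOn (s := Icc a b))
  refine ⟨(max C D).toNNReal, fun t ht => ⟨?_, ?_⟩⟩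
  · exact (hC t ht).trans ((le_max_left _ _).trans (Real.le_coe_toNNReal _))
  · exact (hD t ht).trans ((le_max_right _ _).trans (Real.le_coe_toNNReal _))

theorem exists_pruferAngle_Ioo {p q : ℝ → ℝ} (hp : Continuous p) (hq : Continuous q)
    (hpos : ∀ t, 0 < p t) (μ α : ℝ) {R : ℝ} (hR : 0 < R) :
    ∃ θ : ℝ → ℝ, θ 0 = α ∧
      ∀ t ∈ Ioo (-R) R, HasDerivAt θ (pruferField p q μ t (θ t)) t := by
  obtain ⟨C, hC⟩ := exists_bound_coeff hp hq hpos μ (-R) R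
  have h0 : (0 : ℝ) ∈ Icc (-R) R := ⟨by linarith, hR.le⟩
  have hbd : ∀ t ∈ Icc (-R) R, ∀ x, |pruferField p q μ t x| ≤ (2 * C : NNReal) := by
    intro t ht x
    have hx : pruferField p q μ t x =
        1 / p t + (μ - q t - 1 / p t) * Real.sin x ^ 2 := by
      have hc : Real.cos x ^ 2 = 1 - Real.sin x ^ 2 := by
        linarith [Real.sin_sq_add_cos_sq x]
      rw [pruferField, hc]; ring
    rw [hx]
    refine (abs_add_le _ _).trans ?_
    rw [abs_mul, abs_of_nonneg (sq_nonneg (Real.sin x))]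
    have := mul_le_of_le_one_right (abs_nonneg (μ - q t - 1 / p t)) (Real.sin_sq_le_one x)
    have h2 := hC t ht
    push_cast
    linarith [h2.1, h2.2]
  -- The field is bounded by 2C, so a ball of radius 2CR cannot be left within time R, and the
  -- solution exists on the whole interval.
  have hPL : IsPicardLindelof (pruferField p q μ) (⟨0, h0⟩ : Icc (-R) R) α
      (2 * C * R.toNNReal) 0 (2 * C) C := by
    refine ⟨?_, ?_, fun t ht x _ => hbd t ht x, ?_⟩
    · intro t ht
      refine (LipschitzWith.of_dist_le_mul fun x y => ?_).lipschitzOnWith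
      rw [Real.dist_eq, Real.dist_eq]
      have := abs_pruferField_sub_le p q μ μ t y x
      rw [sub_self, abs_zero, add_zero] at this
      exact this.trans (mul_le_mul_of_nonneg_right (hC t ht).1 (abs_nonneg _))
    · intro x _
      refine Continuous.continuousOn ?_
      unfold pruferField
      exact (continuous_const.div hp fun t => (hpos t).ne').add
        ((continuous_const.sub hq).mul continuous_const)
    · simp [hR.le]
  obtain ⟨θ, hθ0, hθ⟩ := hPL.exists_eq_forall_mem_Icc_hasDerivWithinAt₀
  exact ⟨θ, hθ0, fun t ht => (hθ t (Ioo_subset_Icc_self ht)).hasDerivAt (Icc_mem_nhds ht.1 ht.2)⟩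

theorem exists_isPruferAngle {p q : ℝ → ℝ} (hp : Continuous p) (hq : Continuous q)
    (hpos : ∀ t, 0 < p t) (μ α : ℝ) : ∃ θ : ℝ → ℝ, θ 0 = α ∧ IsPruferAngle p q μ θ := by
  choose! ψ hψ0 hψ using fun R (hR : 0 < R) => exists_pruferAngle_Ioo hp hq hpos μ α hR
  have huniq : ∀ R R' : ℝ, 0 < R → R ≤ R' → EqOn (ψ R) (ψ R') (Ioo (-R) R) := by
    intro R R' hR hRR'
    obtain ⟨C, hC⟩ := exists_bound_coeff hp hq hpos μ (-R) R
    refine ODE_solution_unique_of_mem_Ioo (v := pruferField p q μ) (s := fun _ => univ) (K := C)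
      (t₀ := 0) ?_ ⟨by linarith, hR⟩ (fun t ht => ⟨hψ R hR t ht, trivial⟩)
      (fun t ht => ⟨hψ R' (hR.trans_le hRR') t ⟨by linarith [ht.1], by linarith [ht.2]⟩, trivial⟩)
      (by rw [hψ0 R hR, hψ0 R' (hR.trans_le hRR')])
    intro t ht
    refine (LipschitzWith.of_dist_le_mul fun x y => ?_).lipschitzOnWith
    rw [Real.dist_eq, Real.dist_eq]
    have := abs_pruferField_sub_le p q μ μ t y x
    rw [sub_self, abs_zero, add_zero] at this
    exact this.trans (mul_le_mul_of_nonneg_right (hC t (Ioo_subset_Icc_self ht)).1 (abs_nonneg _))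
  -- Glue the local solutions: near t, all those used agree with the one on the larger interval of
  -- half-length |t| + 2.
  refine ⟨fun t => ψ (|t| + 1) t, hψ0 _ (by positivity), fun t => ?_⟩
  have hpos' : ∀ s : ℝ, 0 < |s| + 1 := fun s => by positivity
  have key : ∀ s : ℝ, |s| < |t| + 1 → ψ (|s| + 1) s = ψ (|t| + 2) s := fun s hs =>
    huniq (|s| + 1) (|t| + 2) (hpos' s) (by linarith) (abs_lt.1 (by linarith))
  have hev : (fun s => ψ (|s| + 1) s) =ᶠ[𝓝 t] ψ (|t| + 2) := by
    filter_upwards [continuous_abs.continuousAt.eventually_lt continuousAt_const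
      (by linarith : |t| < |t| + 1)] with s hs using key s hs
  have h := hψ (|t| + 2) (by positivity) t (abs_lt.1 (by linarith))
  rw [← key t (by linarith)] at h
  exact h.congr_of_eventuallyEq hev

/-! ### Scalar linear differential equations with nonnegative inhomogeneity -/

section LinearInequality

variable {δ a b : ℝ → ℝ}

/-- Multiplication by the integrating factor of `δ' = a δ + b`. -/
theorem hasDerivAt_mul_integratingFactor (ha : Continuous a)
    (hδ : ∀ t, HasDerivAt δ (a t * δ t + b t) t) (t : ℝ) :
    HasDerivAt (fun t => δ t * Real.exp (-∫ s in (0 : ℝ)..t, a s))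
      (b t * Real.exp (-∫ s in (0 : ℝ)..t, a s)) t := by
  have h := (hδ t).mul ((ha.integral_hasStrictDerivAt 0 t).hasDerivAt.neg.exp)
  refine h.congr_deriv ?_
  simp only [Pi.neg_apply]
  ring

theorem monotone_mul_integratingFactor (ha : Continuous a)
    (hδ : ∀ t, HasDerivAt δ (a t * δ t + b t) t) (hb : ∀ t, 0 ≤ b t) :
    Monotone fun t => δ t * Real.exp (-∫ s in (0 : ℝ)..t, a s) :=
  monotone_of_hasDerivAt_nonneg (hasDerivAt_mul_integratingFactor ha hδ)
    fun t => mul_nonneg (hb t) (Real.exp_pos _).le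

theorem nonneg_of_linear_deriv (ha : Continuous a)
    (hδ : ∀ t, HasDerivAt δ (a t * δ t + b t) t) (hb : ∀ t, 0 ≤ b t) (h0 : 0 ≤ δ 0) {t : ℝ}
    (ht : 0 ≤ t) : 0 ≤ δ t := by
  have h := monotone_mul_integratingFactor ha hδ hb ht
  simp only [intervalIntegral.integral_same, neg_zero, Real.exp_zero, mul_one] at h
  exact nonneg_of_mul_nonneg_left (h0.trans h) (Real.exp_pos _)

theorem pos_of_linear_deriv (ha : Continuous a)
    (hδ : ∀ t, HasDerivAt δ (a t * δ t + b t) t) (hb : ∀ t, 0 ≤ b t) (h0 : 0 < δ 0) {t : ℝ}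
    (ht : 0 ≤ t) : 0 < δ t := by
  have h := monotone_mul_integratingFactor ha hδ hb ht
  simp only [intervalIntegral.integral_same, neg_zero, Real.exp_zero, mul_one] at h
  exact pos_of_mul_pos_left (h0.trans_le h) (Real.exp_pos _).le

theorem eq_mul_exp_of_linear_deriv (ha : Continuous a)
    (hδ : ∀ t, HasDerivAt δ (a t * δ t) t) (t : ℝ) :
    δ t = δ 0 * Real.exp (∫ s in (0 : ℝ)..t, a s) := by
  have hd := hasDerivAt_mul_integratingFactor (b := fun _ => 0) ha (by simpa using hδ)
  have h := is_const_of_deriv_eq_zero (fun t => (hd t).differentiableAt)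
    (fun t => by simpa using (hd t).deriv) t 0
  simp only [intervalIntegral.integral_same, neg_zero, Real.exp_zero, mul_one] at h
  rw [← h, mul_assoc, ← Real.exp_add, neg_add_cancel, Real.exp_zero, mul_one]

/-- If `δ` starts at `0` and does not become positive, the inhomogeneity vanishes meanwhile. -/
theorem eq_zero_of_linear_deriv (ha : Continuous a)
    (hδ : ∀ t, HasDerivAt δ (a t * δ t + b t) t) (hb : ∀ t, 0 ≤ b t) (h0 : δ 0 = 0) {T : ℝ}
    (hT : δ T ≤ 0) {t : ℝ} (ht : t ∈ Ioo 0 T) : b t = 0 := by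
  have hm := monotone_mul_integratingFactor ha hδ hb
  have hconst : ∀ s ∈ Ioo 0 T, δ s * Real.exp (-∫ s in (0 : ℝ)..s, a s) = 0 := by
    intro s hs
    have h1 := hm hs.1.le
    have h2 := hm hs.2.le
    simp only [h0, zero_mul] at h1 h2
    exact le_antisymm (h2.trans (mul_nonpos_of_nonpos_of_nonneg hT (Real.exp_pos _).le)) h1
  have hd := hasDerivAt_mul_integratingFactor ha hδ t
  have hev : (fun t => δ t * Real.exp (-∫ s in (0 : ℝ)..t, a s)) =ᶠ[𝓝 t] fun _ => 0 := by
    filter_upwards [Ioo_mem_nhds ht.1 ht.2] with s hs using hconst s hs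
  have := hd.unique ((hasDerivAt_const t (0 : ℝ)).congr_of_eventuallyEq hev)
  exact (mul_eq_zero.1 this).resolve_right (Real.exp_pos _).ne'

end LinearInequality

/-! ### Dependence of the Prüfer angle on the initial angle and on the eigenvalue -/

/-- Continuous coefficients of a Sturm–Liouville equation, the leading one being positive. -/
structure SLCoefficients (p q : ℝ → ℝ) : Prop where
  continuous_p : Continuous p
  continuous_q : Continuous q
  pos : ∀ t, 0 < p t

/-- The solution of the Prüfer equation which is `α` at time `0`. -/
noncomputable def pruferAngle (p q : ℝ → ℝ) (μ α : ℝ) : ℝ → ℝ :=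
  Classical.epsilon fun θ => θ 0 = α ∧ IsPruferAngle p q μ θ

theorem IsPruferAngle.continuous {p q : ℝ → ℝ} {μ : ℝ} {θ : ℝ → ℝ}
    (h : IsPruferAngle p q μ θ) : Continuous θ :=
  continuous_iff_continuousAt.2 fun t => (h t).continuousAt

namespace SLCoefficients

variable {p q : ℝ → ℝ} (hc : SLCoefficients p q)
include hc

theorem continuous_inv : Continuous fun t => 1 / p t :=
  continuous_const.div hc.continuous_p fun t => (hc.pos t).ne'

theorem pruferAngle_zero (μ α : ℝ) : pruferAngle p q μ α 0 = α :=
  (Classical.epsilon_spec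
    (exists_isPruferAngle hc.continuous_p hc.continuous_q hc.pos μ α)).1

theorem isPruferAngle (μ α : ℝ) : IsPruferAngle p q μ (pruferAngle p q μ α) :=
  (Classical.epsilon_spec
    (exists_isPruferAngle hc.continuous_p hc.continuous_q hc.pos μ α)).2

/-- The difference of two Prüfer angles solves a linear equation. -/
theorem exists_linear_deriv_sub {μ ν : ℝ} {θ η : ℝ → ℝ} (hθ : IsPruferAngle p q μ θ)
    (hη : IsPruferAngle p q ν η) :
    ∃ a : ℝ → ℝ, Continuous a ∧ ∀ t, HasDerivAt (fun t => η t - θ t)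
      (a t * (η t - θ t) + (ν - μ) * Real.sin (θ t) ^ 2) t := by
  refine ⟨fun t => (ν - q t - 1 / p t) * Real.sin (θ t + η t) * Real.sinc (η t - θ t), ?_,
    fun t => ?_⟩
  · exact (((continuous_const.sub hc.continuous_q).sub hc.continuous_inv).mul
      (Real.continuous_sin.comp (hθ.continuous.add hη.continuous))).mul
      (Real.continuous_sinc.comp (hη.continuous.sub hθ.continuous))
  · have := (hη t).sub (hθ t)
    rwa [pruferField_sub] at this

theorem pruferAngle_unique {μ : ℝ} {θ : ℝ → ℝ} (hθ : IsPruferAngle p q μ θ) :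
    θ = pruferAngle p q μ (θ 0) := by
  obtain ⟨a, ha, hd⟩ := hc.exists_linear_deriv_sub (hc.isPruferAngle μ (θ 0)) hθ
  funext t
  have := eq_mul_exp_of_linear_deriv ha (by simpa using hd) t
  rw [hc.pruferAngle_zero, sub_self, zero_mul] at this
  linarith

theorem pruferAngle_add_int_mul_pi (μ α : ℝ) (k : ℤ) (t : ℝ) :
    pruferAngle p q μ (α + k * Real.pi) t = pruferAngle p q μ α t + k * Real.pi := by
  have h : IsPruferAngle p q μ fun t => pruferAngle p q μ α t + k * Real.pi := by
    intro t
    refine ((hc.isPruferAngle μ α t).add_const (k * Real.pi)).congr_deriv ?_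
    unfold pruferField
    rw [Real.sin_add_int_mul_pi, Real.cos_add_int_mul_pi, mul_pow, mul_pow]
    have : ((-1 : ℝ) ^ k) ^ 2 = 1 := by
      rcases Int.even_or_odd k with h | h
      · simp [h.neg_one_zpow]
      · simp [h.neg_one_zpow]
    simp [this]
  have := hc.pruferAngle_unique h
  rw [hc.pruferAngle_zero] at this
  exact (congrFun this t).symm

theorem pruferAngle_add_time {τ : ℝ} (hp : Function.Periodic p τ) (hq : Function.Periodic q τ)
    (μ α t : ℝ) :
    pruferAngle p q μ α (t + τ) = pruferAngle p q μ (pruferAngle p q μ α τ) t := by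
  have h : IsPruferAngle p q μ fun t => pruferAngle p q μ α (t + τ) := by
    intro t
    refine ((hc.isPruferAngle μ α (t + τ)).comp_add_const t τ).congr_deriv ?_
    unfold pruferField
    rw [hp t, hq t]
  have := hc.pruferAngle_unique h
  simp only [zero_add] at this
  exact congrFun this t

theorem pruferAngle_strictMono (μ : ℝ) {t : ℝ} (ht : 0 ≤ t) :
    StrictMono fun α => pruferAngle p q μ α t := by
  intro α β hαβ
  obtain ⟨a, ha, hd⟩ := hc.exists_linear_deriv_sub (hc.isPruferAngle μ α) (hc.isPruferAngle μ β)
  have := pos_of_linear_deriv ha hd (fun t => by simp)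
    (by simpa [hc.pruferAngle_zero] using hαβ) ht
  exact sub_pos.1 this

/-- Otherwise the inhomogeneity (ν - μ) sin² θ would vanish throughout (0, T), so sin θ would be
zero there. This is impossible, because θ has derivative 1 / p > 0 wherever sin θ = 0. -/
theorem pruferAngle_strictMono_eigenvalue (α : ℝ) {T : ℝ} (hT : 0 < T) :
    StrictMono fun μ => pruferAngle p q μ α T := by
  intro μ ν hμν
  by_contra hle
  have hθ := hc.isPruferAngle μ α
  obtain ⟨a, ha, hd⟩ := hc.exists_linear_deriv_sub hθ (hc.isPruferAngle ν α)
  have hzero : ∀ t ∈ Ioo 0 T, Real.sin (pruferAngle p q μ α t) = 0 := fun t ht => by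
    have := eq_zero_of_linear_deriv ha hd
      (fun t => mul_nonneg (sub_nonneg.2 hμν.le) (sq_nonneg _))
      (by rw [hc.pruferAngle_zero, hc.pruferAngle_zero, sub_self])
      (sub_nonpos.2 (not_lt.1 hle)) ht
    exact pow_eq_zero_iff two_ne_zero |>.1
      ((mul_eq_zero.1 this).resolve_left (sub_pos.2 hμν).ne')
  have hmid : T / 2 ∈ Ioo 0 T := ⟨by linarith, by linarith⟩
  have hev : (fun t => Real.sin (pruferAngle p q μ α t)) =ᶠ[𝓝 (T / 2)] fun _ => 0 := by
    filter_upwards [Ioo_mem_nhds hmid.1 hmid.2] with s hs using hzero s hs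
  have hderiv := (hθ (T / 2)).sin.unique
    ((hasDerivAt_const (T / 2) (0 : ℝ)).congr_of_eventuallyEq hev)
  have hcos : Real.cos (pruferAngle p q μ α (T / 2)) ^ 2 = 1 := by
    have := Real.sin_sq_add_cos_sq (pruferAngle p q μ α (T / 2))
    rw [hzero _ hmid] at this
    linarith
  rw [pruferField, hzero _ hmid, hcos] at hderiv
  have hp := hc.pos (T / 2)
  rcases mul_eq_zero.1 hderiv with h | h
  · rw [h] at hcos
    norm_num at hcos
  · have : 0 < 1 / p (T / 2) := by positivity
    norm_num at h
    exact hp.ne' h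

/-- The angle crosses the multiples of `π` upwards only. -/
theorem pruferAngle_zero_pos (μ : ℝ) {T : ℝ} (hT : 0 < T) : 0 < pruferAngle p q μ 0 T := by
  have hθ := hc.isPruferAngle μ 0
  have ha : Continuous fun t => (μ - q t - 1 / p t) * Real.sin (pruferAngle p q μ 0 t) *
      Real.sinc (pruferAngle p q μ 0 t) :=
    (((continuous_const.sub hc.continuous_q).sub hc.continuous_inv).mul
      (Real.continuous_sin.comp hθ.continuous)).mul (Real.continuous_sinc.comp hθ.continuous)
  -- The field is expanded about the angle 0, where it equals 1 / p; this positive value becomes the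
  -- inhomogeneity.
  have hd : ∀ t, HasDerivAt (pruferAngle p q μ 0)
      ((μ - q t - 1 / p t) * Real.sin (pruferAngle p q μ 0 t) *
        Real.sinc (pruferAngle p q μ 0 t) * pruferAngle p q μ 0 t + 1 / p t) t := by
    intro t
    refine (hθ t).congr_deriv ?_
    rw [mul_assoc _ (Real.sinc _), Real.sinc_mul_self, pruferField]
    have : Real.cos (pruferAngle p q μ 0 t) ^ 2 = 1 - Real.sin (pruferAngle p q μ 0 t) ^ 2 := by
      linarith [Real.sin_sq_add_cos_sq (pruferAngle p q μ 0 t)]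
    rw [this]
    ring
  by_contra hle
  have hmid : T / 2 ∈ Ioo 0 T := ⟨by linarith, by linarith⟩
  have := eq_zero_of_linear_deriv ha hd (fun t => (one_div_pos.2 (hc.pos t)).le)
    (hc.pruferAngle_zero μ 0) (not_lt.1 hle) hmid
  exact (one_div_pos.2 (hc.pos (T / 2))).ne' this

/-- For small `μ` the angle does not cross `π / 2` upwards. -/
theorem pruferAngle_pi_div_two_le {μ : ℝ} (hμ : ∀ t, μ ≤ q t) {T : ℝ} (hT : 0 ≤ T) :
    pruferAngle p q μ (Real.pi / 2) T ≤ Real.pi / 2 := by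
  set θ := pruferAngle p q μ (Real.pi / 2) with hθdef
  have hθ : IsPruferAngle p q μ θ := hc.isPruferAngle μ _
  have hcont : Continuous fun t => Real.pi / 2 - θ t := continuous_const.sub hθ.continuous
  have ha : Continuous fun t => -(1 / p t * Real.sin (Real.pi / 2 - θ t) *
      Real.sinc (Real.pi / 2 - θ t)) :=
    ((hc.continuous_inv.mul (Real.continuous_sin.comp hcont)).mul
      (Real.continuous_sinc.comp hcont)).neg
  have hd : ∀ t, HasDerivAt (fun t => Real.pi / 2 - θ t)
      (-(1 / p t * Real.sin (Real.pi / 2 - θ t) * Real.sinc (Real.pi / 2 - θ t)) *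
        (Real.pi / 2 - θ t) + (q t - μ) * Real.sin (θ t) ^ 2) t := by
    intro t
    refine ((hθ t).const_sub (Real.pi / 2)).congr_deriv ?_
    rw [neg_mul, mul_assoc _ (Real.sinc _), Real.sinc_mul_self, Real.sin_pi_div_two_sub,
      pruferField]
    ring
  have := nonneg_of_linear_deriv ha hd
    (fun t => mul_nonneg (sub_nonneg.2 (hμ t)) (sq_nonneg _))
    (by rw [hθdef, hc.pruferAngle_zero, sub_self]) hT
  linarith

/-- Grönwall's inequality, with initial error |α - β| and forcing |μ - ν|, gives an explicit bound
that tends to 0. -/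
theorem continuous_pruferAngle_initial {T : ℝ} (hT : 0 ≤ T) :
    Continuous fun x : ℝ × ℝ => pruferAngle p q x.1 x.2 T := by
  refine continuous_iff_continuousAt.2 fun ⟨μ, α⟩ => ?_
  obtain ⟨C, hC⟩ := exists_bound_coeff hc.continuous_p hc.continuous_q hc.pos μ 0 T
  have hbound : ∀ x : ℝ × ℝ,
      dist (pruferAngle p q x.1 x.2 T) (pruferAngle p q μ α T) ≤
        gronwallBound |α - x.2| C |μ - x.1| (T - 0) := by
    rintro ⟨ν, β⟩
    have hd := fun t => (hc.isPruferAngle μ α t).sub (hc.isPruferAngle ν β t)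
    have := norm_le_gronwallBound_of_norm_deriv_right_le (a := 0) (b := T)
      (δ := |α - β|) (K := C) (ε := |μ - ν|)
      ((hc.isPruferAngle μ α).continuous.sub (hc.isPruferAngle ν β).continuous).continuousOn
      (fun t _ => (hd t).hasDerivWithinAt)
      (by simp [hc.pruferAngle_zero])
      (fun t ht => (abs_pruferField_sub_le p q ν μ t _ _).trans
        (add_le_add_left (mul_le_mul_of_nonneg_right (hC t (Ico_subset_Icc_self ht)).1
          (abs_nonneg _)) _)) T ⟨hT, le_rfl⟩
    rw [dist_comm]
    exact this
  have hlim : Tendsto (fun x : ℝ × ℝ => gronwallBound |α - x.2| C |μ - x.1| (T - 0))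
      (𝓝 (μ, α)) (𝓝 0) := by
    have hcont : Continuous fun x : ℝ × ℝ => gronwallBound |α - x.2| C |μ - x.1| (T - 0) := by
      unfold gronwallBound
      split_ifs <;> fun_prop
    have := hcont.tendsto (μ, α)
    simpa [gronwallBound_ε0_δ0] using this
  exact tendsto_iff_dist_tendsto_zero.2
    (squeeze_zero (fun _ => dist_nonneg) hbound hlim)

end SLCoefficients

/-! ### The Prüfer radius and the reconstruction of all solutions -/

/-- The logarithmic derivative of the Prüfer radius along the Prüfer angle. -/
noncomputable def pruferRate (p q : ℝ → ℝ) (μ α t : ℝ) : ℝ :=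
  Real.sin (pruferAngle p q μ α t) * Real.cos (pruferAngle p q μ α t) * (1 / p t - (μ - q t))

/-- The Prüfer radius, normalised to be `1` at time `0`. -/
noncomputable def pruferRadius (p q : ℝ → ℝ) (μ α t : ℝ) : ℝ :=
  Real.exp (∫ s in (0 : ℝ)..t, pruferRate p q μ α s)

/-- The solution `h` of the Sturm–Liouville equation with `h 0 = sin α` and
`p 0 * h' 0 = cos α`. -/
noncomputable def pruferSolution (p q : ℝ → ℝ) (μ α t : ℝ) : ℝ :=
  pruferRadius p q μ α t * Real.sin (pruferAngle p q μ α t)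

/-- The solutions of the Sturm–Liouville equation form a vector space. -/
def slSolutionSpace (p q : ℝ → ℝ) (μ : ℝ) : Submodule ℝ (ℝ → ℝ) where
  carrier := {h | SLSolution p q μ h}
  zero_mem' := by
    refine ⟨differentiable_const 0, ?_, fun t => ?_⟩
    · simp [Pi.zero_def]
    · simp [Pi.zero_def]
  add_mem' := by
    rintro u v ⟨hu, hu', hu''⟩ ⟨hv, hv', hv''⟩
    have h : (fun t => p t * deriv (u + v) t) =
        (fun t => p t * deriv u t) + fun t => p t * deriv v t := by
      funext t
      rw [Pi.add_apply, deriv_add (hu t) (hv t), mul_add]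
    refine ⟨hu.add hv, h ▸ hu'.add hv', fun t => ?_⟩
    rw [h, deriv_add (hu' t) (hv' t), Pi.add_apply]
    linear_combination hu'' t + hv'' t
  smul_mem' := by
    rintro c u ⟨hu, hu', hu''⟩
    have h : (fun t => p t * deriv (c • u) t) = c • fun t => p t * deriv u t := by
      funext t
      rw [deriv_const_smul c (hu t)]
      simp only [Pi.smul_apply, smul_eq_mul]
      ring
    refine ⟨hu.const_smul c, h ▸ hu'.const_smul c, fun t => ?_⟩
    rw [h, deriv_const_smul c (hu' t), Pi.smul_apply, smul_eq_mul, smul_eq_mul]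
    linear_combination c * hu'' t

theorem SLSolution.comp_add_const {p q : ℝ → ℝ} {μ : ℝ} {h : ℝ → ℝ} (hh : SLSolution p q μ h)
    {τ : ℝ} (hp : Function.Periodic p τ) (hq : Function.Periodic q τ) :
    SLSolution p q μ fun t => h (t + τ) := by
  obtain ⟨h1, h2, h3⟩ := hh
  have e : (fun t => p t * deriv (fun t => h (t + τ)) t) =
      fun t => (fun t => p t * deriv h t) (t + τ) := by
    funext t
    simp only [deriv_comp_add_const, hp t]
  refine ⟨h1.comp (differentiable_id.add_const τ), ?_, fun t => ?_⟩
  · rw [e]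
    exact h2.comp (differentiable_id.add_const τ)
  · rw [e, deriv_comp_add_const (f := fun t => p t * deriv h t), ← hq t]
    exact h3 (t + τ)

theorem exists_polar (x y : ℝ) : ∃ c α : ℝ, x = c * Real.sin α ∧ y = c * Real.cos α :=
  ⟨‖(⟨y, x⟩ : ℂ)‖, Complex.arg ⟨y, x⟩, (Complex.norm_mul_sin_arg ⟨y, x⟩).symm,
    (Complex.norm_mul_cos_arg ⟨y, x⟩).symm⟩

theorem pruferRadius_pos (p q : ℝ → ℝ) (μ α t : ℝ) : 0 < pruferRadius p q μ α t :=
  Real.exp_pos _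

theorem pruferRadius_zero (p q : ℝ → ℝ) (μ α : ℝ) : pruferRadius p q μ α 0 = 1 := by
  simp [pruferRadius]

namespace SLCoefficients

variable {p q : ℝ → ℝ} (hc : SLCoefficients p q)
include hc

theorem continuous_pruferRate (μ α : ℝ) : Continuous (pruferRate p q μ α) := by
  have hθ := (hc.isPruferAngle μ α).continuous
  exact ((Real.continuous_sin.comp hθ).mul (Real.continuous_cos.comp hθ)).mul
    (hc.continuous_inv.sub (continuous_const.sub hc.continuous_q))

theorem hasDerivAt_pruferRadius (μ α t : ℝ) :
    HasDerivAt (pruferRadius p q μ α) (pruferRadius p q μ α t * pruferRate p q μ α t) t :=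
  ((hc.continuous_pruferRate μ α).integral_hasStrictDerivAt 0 t).hasDerivAt.exp

theorem pruferSolution_zero (μ α : ℝ) : pruferSolution p q μ α 0 = Real.sin α := by
  rw [pruferSolution, pruferRadius_zero, hc.pruferAngle_zero, one_mul]

theorem hasDerivAt_pruferSolution (μ α t : ℝ) :
    HasDerivAt (pruferSolution p q μ α)
      (pruferRadius p q μ α t * Real.cos (pruferAngle p q μ α t) / p t) t := by
  refine ((hc.hasDerivAt_pruferRadius μ α t).mul (hc.isPruferAngle μ α t).sin).congr_deriv ?_
  rw [pruferRate, pruferField]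
  have h := Real.sin_sq_add_cos_sq (pruferAngle p q μ α t)
  have hp := (hc.pos t).ne'
  field_simp
  linear_combination pruferRadius p q μ α t * Real.cos (pruferAngle p q μ α t) * h

/-- The quasi-derivative of `pruferSolution`. -/
theorem mul_deriv_pruferSolution (μ α t : ℝ) :
    p t * deriv (pruferSolution p q μ α) t =
      pruferRadius p q μ α t * Real.cos (pruferAngle p q μ α t) := by
  rw [(hc.hasDerivAt_pruferSolution μ α t).deriv, mul_div_cancel₀ _ (hc.pos t).ne']

theorem slSolution_pruferSolution (μ α : ℝ) : SLSolution p q μ (pruferSolution p q μ α) := by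
  have hd : ∀ t, HasDerivAt (fun t => p t * deriv (pruferSolution p q μ α) t)
      ((q t - μ) * pruferSolution p q μ α t) t := by
    intro t
    rw [funext (hc.mul_deriv_pruferSolution μ α)]
    refine ((hc.hasDerivAt_pruferRadius μ α t).mul (hc.isPruferAngle μ α t).cos).congr_deriv ?_
    rw [pruferRate, pruferField, pruferSolution]
    have h := Real.sin_sq_add_cos_sq (pruferAngle p q μ α t)
    have hp := (hc.pos t).ne'
    field_simp
    linear_combination (-p t * (μ - q t) * pruferRadius p q μ α t *
      Real.sin (pruferAngle p q μ α t)) * h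
  refine ⟨fun t => (hc.hasDerivAt_pruferSolution μ α t).differentiableAt,
    fun t => (hd t).differentiableAt, fun t => ?_⟩
  rw [(hd t).deriv]
  ring

/-- A solution is determined by its initial values. -/
theorem eq_smul_pruferSolution {μ : ℝ} {v : ℝ → ℝ} (hv : SLSolution p q μ v) {c α : ℝ}
    (h0 : v 0 = c * Real.sin α) (h1 : p 0 * deriv v 0 = c * Real.cos α) :
    v = c • pruferSolution p q μ α := by
  obtain ⟨hd, hd', heq⟩ := hv
  set θ := pruferAngle p q μ α with hθdef
  have hθ : IsPruferAngle p q μ θ := hc.isPruferAngle μ α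
  set y : ℝ → ℝ := fun t => p t * deriv v t with hy
  have hv' : ∀ t, HasDerivAt v (y t / p t) t := fun t => by
    have := (hd t).hasDerivAt
    rwa [← mul_div_cancel_left₀ (deriv v t) (hc.pos t).ne'] at this
  have hy' : ∀ t, HasDerivAt y ((q t - μ) * v t) t := fun t => by
    refine (hd' t).hasDerivAt.congr_deriv ?_
    linear_combination -heq t
  have hy0 : y 0 = c * Real.cos α := h1
  clear_value y
  have hθ0 : θ 0 = α := hc.pruferAngle_zero μ α
  -- The component of (v, p v') orthogonal to the Prüfer direction satisfies a homogeneous linear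
  -- equation and vanishes at 0. The component along that direction then grows at the rate of the
  -- Prüfer radius.
  have hX : ∀ t, v t * Real.cos (θ t) - y t * Real.sin (θ t) = 0 := by
    have hX' : ∀ t, HasDerivAt (fun t => v t * Real.cos (θ t) - y t * Real.sin (θ t))
        (-pruferRate p q μ α t * (v t * Real.cos (θ t) - y t * Real.sin (θ t))) t := by
      intro t
      refine (((hv' t).mul (hθ t).cos).sub ((hy' t).mul (hθ t).sin)).congr_deriv ?_
      rw [pruferRate, ← hθdef, pruferField]
      have h := Real.sin_sq_add_cos_sq (θ t)
      have hp := (hc.pos t).ne'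
      field_simp
      linear_combination (-(y t * Real.cos (θ t)) - (μ - q t) * p t * v t * Real.sin (θ t)) * h
    intro t
    rw [eq_mul_exp_of_linear_deriv (hc.continuous_pruferRate μ α).neg hX' t, hθ0, h0, hy0]
    ring
  have hR : ∀ t, v t * Real.sin (θ t) + y t * Real.cos (θ t) = c * pruferRadius p q μ α t := by
    have hR' : ∀ t, HasDerivAt (fun t => v t * Real.sin (θ t) + y t * Real.cos (θ t))
        (pruferRate p q μ α t * (v t * Real.sin (θ t) + y t * Real.cos (θ t))) t := by
      intro t
      refine (((hv' t).mul (hθ t).sin).add ((hy' t).mul (hθ t).cos)).congr_deriv ?_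
      have hXt := hX t
      rw [pruferRate, ← hθdef, pruferField]
      have h := Real.sin_sq_add_cos_sq (θ t)
      have hp := (hc.pos t).ne'
      field_simp
      linear_combination (Real.cos (θ t) ^ 2 - Real.sin (θ t) ^ 2 +
        p t * (μ - q t) * (Real.sin (θ t) ^ 2 - Real.cos (θ t) ^ 2)) * hXt +
        (p t * (μ - q t) * v t * Real.cos (θ t) - y t * Real.sin (θ t)) * h
    intro t
    rw [eq_mul_exp_of_linear_deriv (hc.continuous_pruferRate μ α) hR' t, hθ0, h0, hy0]
    have h := Real.sin_sq_add_cos_sq α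
    rw [pruferRadius]
    linear_combination c * Real.exp (∫ s in (0 : ℝ)..t, pruferRate p q μ α s) * h
  funext t
  rw [Pi.smul_apply, smul_eq_mul, pruferSolution, ← mul_assoc, ← hR t, ← hθdef]
  have h := Real.sin_sq_add_cos_sq (θ t)
  linear_combination Real.cos (θ t) * hX t - v t * h

theorem exists_eq_smul_pruferSolution {μ : ℝ} {v : ℝ → ℝ} (hv : SLSolution p q μ v) :
    ∃ c α : ℝ, v = c • pruferSolution p q μ α := by
  obtain ⟨c, α, h0, h1⟩ := exists_polar (v 0) (p 0 * deriv v 0)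
  exact ⟨c, α, hc.eq_smul_pruferSolution hv h0 h1⟩

theorem mul_deriv_pruferSolution_zero (μ α : ℝ) :
    p 0 * deriv (pruferSolution p q μ α) 0 = Real.cos α := by
  rw [hc.mul_deriv_pruferSolution, pruferRadius_zero, hc.pruferAngle_zero, one_mul]

theorem pruferSolution_ne_zero (μ α : ℝ) : pruferSolution p q μ α ≠ 0 := by
  intro h
  have h0 := hc.pruferSolution_zero μ α
  have h1 := hc.mul_deriv_pruferSolution_zero μ α
  have hsq := Real.sin_sq_add_cos_sq α
  rw [h] at h0 h1
  simp only [Pi.zero_apply, Pi.zero_def, deriv_const, mul_zero] at h0 h1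
  rw [← h0, ← h1] at hsq
  norm_num at hsq

theorem pruferSolution_add_int_mul_pi (μ α : ℝ) (k : ℤ) :
    pruferSolution p q μ (α + k * Real.pi) = (-1 : ℝ) ^ k • pruferSolution p q μ α :=
  hc.eq_smul_pruferSolution (hc.slSolution_pruferSolution μ _)
    (by rw [hc.pruferSolution_zero, Real.sin_add_int_mul_pi])
    (by rw [hc.mul_deriv_pruferSolution_zero, Real.cos_add_int_mul_pi])

theorem pruferSolution_add_time {τ : ℝ} (hp : Function.Periodic p τ)
    (hq : Function.Periodic q τ) (μ α t : ℝ) :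
    pruferSolution p q μ α (t + τ) = pruferRadius p q μ α τ *
      pruferSolution p q μ (pruferAngle p q μ α τ) t := by
  refine congrFun (hc.eq_smul_pruferSolution
    ((hc.slSolution_pruferSolution μ α).comp_add_const hp hq) ?_ ?_) t
  · simp only [zero_add, pruferSolution]
  · rw [deriv_comp_add_const, ← hp 0, hc.mul_deriv_pruferSolution, zero_add]

/-- The addition formulas give equality of the initial data, and linearity carries it to all times.
The angles α and α + π / 2 thus provide a basis of solutions adapted to α. -/
theorem pruferSolution_add_angle (μ α s : ℝ) :
    pruferSolution p q μ (α + s) = Real.sin s • pruferSolution p q μ (α + Real.pi / 2) +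
      Real.cos s • pruferSolution p q μ α := by
  have hmem : SLSolution p q μ (Real.sin s • pruferSolution p q μ (α + Real.pi / 2) +
      Real.cos s • pruferSolution p q μ α) :=
    (slSolutionSpace p q μ).add_mem
      ((slSolutionSpace p q μ).smul_mem _ (hc.slSolution_pruferSolution μ _))
      ((slSolutionSpace p q μ).smul_mem _ (hc.slSolution_pruferSolution μ _))
  refine ((hc.eq_smul_pruferSolution (c := 1) (α := α + s) hmem ?_ ?_).trans
    (one_smul _ _)).symm
  · simp only [Pi.add_apply, Pi.smul_apply, smul_eq_mul, hc.pruferSolution_zero, Real.sin_add,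
      Real.sin_pi_div_two, Real.cos_pi_div_two]
    ring
  · rw [((hc.hasDerivAt_pruferSolution μ (α + Real.pi / 2) 0).const_smul (Real.sin s)).add
      ((hc.hasDerivAt_pruferSolution μ α 0).const_smul (Real.cos s)) |>.deriv]
    simp only [smul_eq_mul, pruferRadius_zero, hc.pruferAngle_zero, Real.cos_add,
      Real.sin_pi_div_two, Real.cos_pi_div_two]
    have := (hc.pos 0).ne'
    field_simp
    ring

theorem sin_pruferAngle_add_angle (μ α s t : ℝ) :
    pruferRadius p q μ (α + s) t * Real.sin (pruferAngle p q μ (α + s) t) =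
      Real.sin s * (pruferRadius p q μ (α + Real.pi / 2) t *
        Real.sin (pruferAngle p q μ (α + Real.pi / 2) t)) +
      Real.cos s * (pruferRadius p q μ α t * Real.sin (pruferAngle p q μ α t)) :=
  congrFun (hc.pruferSolution_add_angle μ α s) t

theorem cos_pruferAngle_add_angle (μ α s t : ℝ) :
    pruferRadius p q μ (α + s) t * Real.cos (pruferAngle p q μ (α + s) t) =
      Real.sin s * (pruferRadius p q μ (α + Real.pi / 2) t *
        Real.cos (pruferAngle p q μ (α + Real.pi / 2) t)) +
      Real.cos s * (pruferRadius p q μ α t * Real.cos (pruferAngle p q μ α t)) := by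
  rw [← hc.mul_deriv_pruferSolution μ (α + s), hc.pruferSolution_add_angle,
    ((hc.hasDerivAt_pruferSolution μ (α + Real.pi / 2) t).const_smul (Real.sin s)).add
      ((hc.hasDerivAt_pruferSolution μ α t).const_smul (Real.cos s)) |>.deriv]
  have := (hc.pos t).ne'
  simp only [smul_eq_mul]
  field_simp

/-- Constancy of the Wronskian. -/
theorem pruferRadius_mul_pruferRadius_mul_sin (μ α β t : ℝ) :
    pruferRadius p q μ α t * pruferRadius p q μ β t *
      Real.sin (pruferAngle p q μ β t - pruferAngle p q μ α t) = Real.sin (β - α) := by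
  have hd : ∀ t, HasDerivAt (fun t => pruferRadius p q μ α t * pruferRadius p q μ β t *
      Real.sin (pruferAngle p q μ β t - pruferAngle p q μ α t)) 0 t := by
    intro t
    refine (((hc.hasDerivAt_pruferRadius μ α t).mul (hc.hasDerivAt_pruferRadius μ β t)).mul
      ((hc.isPruferAngle μ β t).sub (hc.isPruferAngle μ α t)).sin).congr_deriv ?_
    have h := Real.sin_sq_add_cos_sq (pruferAngle p q μ α t)
    have h' := Real.sin_sq_add_cos_sq (pruferAngle p q μ β t)
    have hp := (hc.pos t).ne'
    simp only [Pi.mul_apply, Pi.sub_apply, Real.sin_sub, Real.cos_sub, pruferRate, pruferField]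
    generalize Real.sin (pruferAngle p q μ α t) = s at *
    generalize Real.cos (pruferAngle p q μ α t) = c at *
    generalize Real.sin (pruferAngle p q μ β t) = s' at *
    generalize Real.cos (pruferAngle p q μ β t) = c' at *
    field_simp
    linear_combination (pruferRadius p q μ α t * pruferRadius p q μ β t *
      (c * c' + p t * (μ - q t) * (s * s'))) * (h' - h)
  have := is_const_of_deriv_eq_zero (fun t => (hd t).differentiableAt) (fun t => (hd t).deriv) t 0
  simpa [pruferRadius_zero, hc.pruferAngle_zero] using this

end SLCoefficients

/-! ### Exact turns, their iteration and their extremality -/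

/-- After time `T` the solution `pruferSolution p q μ α` has turned by `m` half-turns and has
its initial size again. -/
def IsTurn (p q : ℝ → ℝ) (T μ α : ℝ) (m : ℤ) : Prop :=
  pruferRadius p q μ α T = 1 ∧ pruferAngle p q μ α T = α + m * Real.pi

theorem sin_eq_and_cos_eq_iff {x y : ℝ} :
    (Real.sin x = Real.sin y ∧ Real.cos x = Real.cos y) ↔
      ∃ j : ℤ, x = y + (2 * j : ℤ) * Real.pi := by
  constructor
  · rintro ⟨hs, hc⟩
    obtain ⟨j, hj⟩ := Real.Angle.angle_eq_iff_two_pi_dvd_sub.1 (Real.Angle.cos_sin_inj hc hs)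
    exact ⟨j, by push_cast; linarith⟩
  · rintro ⟨j, rfl⟩
    rw [Real.sin_add_int_mul_pi, Real.cos_add_int_mul_pi, zpow_mul]
    simp

/-- By continuity the inequality extends to s = 0 and s = π, where it reads 0 ≤ a and 0 ≤ -a. -/
theorem eq_zero_of_mul_cos_sub_mul_sin_nonneg {a b : ℝ}
    (h : ∀ s ∈ Ioo 0 Real.pi, 0 ≤ a * Real.cos s - b * Real.sin s) : a = 0 := by
  have hcl : ∀ s ∈ Icc 0 Real.pi, 0 ≤ a * Real.cos s - b * Real.sin s := by
    have hclosed : IsClosed {s : ℝ | 0 ≤ a * Real.cos s - b * Real.sin s} :=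
      isClosed_le continuous_const (by fun_prop)
    have := hclosed.closure_subset_iff.2 h
    rwa [closure_Ioo Real.pi_pos.ne] at this
  have h0 := hcl 0 ⟨le_rfl, Real.pi_pos.le⟩
  have h1 := hcl Real.pi ⟨Real.pi_pos.le, le_rfl⟩
  simp at h0 h1
  linarith

namespace SLCoefficients

variable {p q : ℝ → ℝ} (hc : SLCoefficients p q)
include hc

section Shift

variable {τ : ℝ} (hp : Function.Periodic p τ) (hq : Function.Periodic q τ)
include hp hq

theorem pruferSolution_add_time_of_angle_eq {μ α : ℝ} {m : ℤ}
    (h : pruferAngle p q μ α τ = α + m * Real.pi) (t : ℝ) :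
    pruferSolution p q μ α (t + τ) =
      (pruferRadius p q μ α τ * (-1 : ℝ) ^ m) * pruferSolution p q μ α t := by
  rw [hc.pruferSolution_add_time hp hq, h, hc.pruferSolution_add_int_mul_pi, Pi.smul_apply,
    smul_eq_mul, mul_assoc]

theorem pruferSolution_add_time_of_isTurn {μ α : ℝ} {m : ℤ} (h : IsTurn p q τ μ α m) (t : ℝ) :
    pruferSolution p q μ α (t + τ) = (-1 : ℝ) ^ m * pruferSolution p q μ α t := by
  rw [hc.pruferSolution_add_time_of_angle_eq hp hq h.2, h.1, one_mul]

-- Comparing values and quasi-derivatives at 0 and τ shows that the radius returns to 1, and fixes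
-- the angle modulo 2π only; hence the free summand 2j.
omit hq in
theorem exists_isTurn_of_add_time {μ α : ℝ} {m : ℤ}
    (h : ∀ t, pruferSolution p q μ α (t + τ) = (-1 : ℝ) ^ m * pruferSolution p q μ α t) :
    ∃ j : ℤ, IsTurn p q τ μ α (2 * j + m) := by
  have hs : pruferRadius p q μ α τ * Real.sin (pruferAngle p q μ α τ) =
      Real.sin (α + m * Real.pi) := by
    have := h 0
    rwa [zero_add, hc.pruferSolution_zero, ← Real.sin_add_int_mul_pi] at this
  have hcos : pruferRadius p q μ α τ * Real.cos (pruferAngle p q μ α τ) =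
      Real.cos (α + m * Real.pi) := by
    rw [← hc.mul_deriv_pruferSolution, Real.cos_add_int_mul_pi,
      ← hc.mul_deriv_pruferSolution_zero μ α, ← zero_add τ, hp 0,
      ← deriv_comp_add_const, funext h, deriv_const_mul_field]
    ring
  have hR : pruferRadius p q μ α τ = 1 := by
    have h1 := Real.sin_sq_add_cos_sq (α + m * Real.pi)
    rw [← hs, ← hcos] at h1
    have h2 := Real.sin_sq_add_cos_sq (pruferAngle p q μ α τ)
    have h3 : pruferRadius p q μ α τ ^ 2 = 1 := by
      linear_combination h1 - pruferRadius p q μ α τ ^ 2 * h2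
    exact (pow_eq_one_iff_of_nonneg (pruferRadius_pos p q μ α τ).le two_ne_zero).1 h3
  rw [hR, one_mul] at hs hcos
  obtain ⟨j, hj⟩ := sin_eq_and_cos_eq_iff.1 ⟨hs, hcos⟩
  exact ⟨j, hR, by rw [hj]; push_cast; ring⟩

theorem pruferAngle_succ_mul (μ α : ℝ) (j : ℕ) :
    pruferAngle p q μ α ((j + 1 : ℕ) * τ) =
      pruferAngle p q μ (pruferAngle p q μ α τ) (j * τ) := by
  rw [← hc.pruferAngle_add_time hp hq]
  congr 1
  push_cast
  ring

theorem pruferAngle_mul_of_eq {μ α : ℝ} {m : ℤ} (h : pruferAngle p q μ α τ = α + m * Real.pi)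
    (j : ℕ) : pruferAngle p q μ α (j * τ) = α + (j * m : ℤ) * Real.pi := by
  induction j with
  | zero => simp [hc.pruferAngle_zero]
  | succ j ih =>
    rw [hc.pruferAngle_succ_mul hp hq, h, hc.pruferAngle_add_int_mul_pi, ih]
    push_cast
    ring

/-- The angle map over τ is increasing and commutes with shifts by π, so a strict inequality
survives iteration. At least one step is needed for strictness, hence j + 1. -/
theorem pruferAngle_mul_lt (hτ : 0 ≤ τ) {μ α : ℝ} {m : ℤ}
    (h : pruferAngle p q μ α τ < α + m * Real.pi) (j : ℕ) :
    pruferAngle p q μ α ((j + 1 : ℕ) * τ) < α + ((j + 1 : ℕ) * m : ℤ) * Real.pi := by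
  induction j with
  | zero => simpa using h
  | succ j ih =>
    rw [hc.pruferAngle_succ_mul hp hq]
    refine (hc.pruferAngle_strictMono μ (by positivity) h).trans ?_
    simp only
    rw [hc.pruferAngle_add_int_mul_pi]
    have : α + ((j + 1 + 1 : ℕ) * m : ℤ) * Real.pi =
        α + ((j + 1 : ℕ) * m : ℤ) * Real.pi + m * Real.pi := by
      push_cast; ring
    rw [this]
    linarith

theorem lt_pruferAngle_mul (hτ : 0 ≤ τ) {μ α : ℝ} {m : ℤ}
    (h : α + m * Real.pi < pruferAngle p q μ α τ) (j : ℕ) :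
    α + ((j + 1 : ℕ) * m : ℤ) * Real.pi < pruferAngle p q μ α ((j + 1 : ℕ) * τ) := by
  induction j with
  | zero => simpa using h
  | succ j ih =>
    rw [hc.pruferAngle_succ_mul hp hq]
    refine lt_trans ?_ (hc.pruferAngle_strictMono μ (by positivity) h)
    simp only
    rw [hc.pruferAngle_add_int_mul_pi]
    have : α + ((j + 1 + 1 : ℕ) * m : ℤ) * Real.pi =
        α + ((j + 1 : ℕ) * m : ℤ) * Real.pi + m * Real.pi := by
      push_cast; ring
    rw [this]
    linarith

/-- A turn by `N * m` half-turns in time `N * τ` comes from a turn by `m` half-turns in each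
period `τ`. -/
theorem isTurn_mul_iff (hτ : 0 ≤ τ) {N : ℕ} (hN : N ≠ 0) {μ α : ℝ} {m k : ℤ}
    (h : IsTurn p q (N * τ) μ α k) : IsTurn p q τ μ α m ↔ k = N * m := by
  constructor
  · intro hm
    have := (hc.pruferAngle_mul_of_eq hp hq hm.2 N).symm.trans h.2
    have h2 := mul_right_cancel₀ Real.pi_ne_zero (add_left_cancel this)
    exact_mod_cast h2.symm
  · rintro rfl
    obtain ⟨j, rfl⟩ := Nat.exists_eq_succ_of_ne_zero hN
    -- A strict excess or deficit in one period would persist over N periods.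
    have hangle : pruferAngle p q μ α τ = α + m * Real.pi := by
      rcases lt_trichotomy (pruferAngle p q μ α τ) (α + m * Real.pi) with hlt | heq | hgt
      · exact absurd h.2 (hc.pruferAngle_mul_lt hp hq hτ hlt j).ne
      · exact heq
      · exact absurd h.2 (hc.lt_pruferAngle_mul hp hq hτ hgt j).ne'
    refine ⟨?_, hangle⟩
    have hstep := hc.pruferSolution_add_time_of_angle_eq hp hq hangle
    -- The multiplier over one period has N-th power of absolute value 1; as the radius is positive,
    -- it must be 1.
    have hiter : ∀ (n : ℕ) (t : ℝ), pruferSolution p q μ α (t + n * τ) =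
        (pruferRadius p q μ α τ * (-1 : ℝ) ^ m) ^ n * pruferSolution p q μ α t := by
      intro n
      induction n with
      | zero => simp
      | succ n ih =>
        intro t
        have : t + (n + 1 : ℕ) * τ = (t + n * τ) + τ := by push_cast; ring
        rw [this, hstep, ih, pow_succ]
        ring
    obtain ⟨t, ht⟩ := Function.ne_iff.1 (hc.pruferSolution_ne_zero μ α)
    have hbig := hc.pruferSolution_add_time_of_isTurn (hp.nat_mul (j + 1)) (hq.nat_mul (j + 1))
      h t
    rw [hiter] at hbig
    have habs := congrArg abs (mul_right_cancel₀ ht hbig)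
    rw [abs_pow, abs_mul, abs_zpow, abs_zpow, abs_neg, abs_one, one_zpow, one_zpow, mul_one,
      abs_of_pos (pruferRadius_pos p q μ α τ)] at habs
    exact (pow_eq_one_iff_of_nonneg (pruferRadius_pos p q μ α τ).le j.succ_ne_zero).1 habs

end Shift

section Turn

/-- Squeeze β between consecutive translates α + jπ and α + (j + 1)π, whose turns are known, and use
monotonicity. The bound π is what lets the sign of a sine decide the sign of the difference of
turns. -/
theorem abs_pruferAngle_sub_lt {T : ℝ} (hT : 0 ≤ T) {μ α : ℝ} {m : ℤ}
    (h : pruferAngle p q μ α T = α + m * Real.pi) (β : ℝ) :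
    |pruferAngle p q μ β T - (β + m * Real.pi)| < Real.pi := by
  obtain ⟨j, ⟨hj1, hj2⟩, -⟩ := existsUnique_sub_zsmul_mem_Ico Real.pi_pos β α
  rw [zsmul_eq_mul] at hj1 hj2
  have hmono := hc.pruferAngle_strictMono μ hT
  have h1 := hmono.monotone (show α + j * Real.pi ≤ β by linarith)
  have h2 := hmono (show β < α + (j + 1 : ℤ) * Real.pi by push_cast; linarith)
  simp only [hc.pruferAngle_add_int_mul_pi, h] at h1 h2
  push_cast at h2
  rw [abs_lt]
  constructor <;> linarith

/-- Comparison of two Prüfer angles, in terms of the monodromy in the basis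
`pruferSolution p q μ α`, `pruferSolution p q μ (α + π / 2)`. -/
theorem mul_sin_pruferAngle_sub (μ α s T : ℝ) :
    pruferRadius p q μ α T * pruferRadius p q μ (α + s) T *
        Real.sin (pruferAngle p q μ (α + s) T - (pruferAngle p q μ α T + s)) =
      Real.sin s * ((1 - pruferRadius p q μ α T ^ 2) * Real.cos s -
        pruferRadius p q μ α T * pruferRadius p q μ (α + Real.pi / 2) T *
          Real.cos (pruferAngle p q μ (α + Real.pi / 2) T - pruferAngle p q μ α T) *
          Real.sin s) := by
  have hW := hc.pruferRadius_mul_pruferRadius_mul_sin μ α (α + Real.pi / 2) T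
  rw [add_sub_cancel_left, Real.sin_pi_div_two] at hW
  have hs := hc.sin_pruferAngle_add_angle μ α s T
  have hcs := hc.cos_pruferAngle_add_angle μ α s T
  rw [Real.sin_sub] at hW ⊢
  rw [Real.sin_add, Real.cos_add, Real.cos_sub]
  have h1 := Real.sin_sq_add_cos_sq (pruferAngle p q μ α T)
  generalize Real.sin (pruferAngle p q μ α T) = a at *
  generalize Real.cos (pruferAngle p q μ α T) = b at *
  generalize pruferRadius p q μ α T = R at *
  linear_combination (R * (b * Real.cos s - a * Real.sin s)) * hs -
    (R * (a * Real.cos s + b * Real.sin s)) * hcs + Real.sin s * Real.cos s * hW -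
    (R ^ 2 * Real.sin s * Real.cos s) * h1

/-- At a minimal turn the comparison formula `mul_sin_pruferAngle_sub` has a nonnegative left side
for 0 < s < π. Dividing by sin s and letting s tend to 0 and to π forces the coefficient 1 - r² of
cos s to vanish. -/
theorem radius_eq_one_of_le {T : ℝ} (hT : 0 ≤ T) {μ α : ℝ} {m : ℤ}
    (h : pruferAngle p q μ α T = α + m * Real.pi)
    (hle : ∀ β, β + m * Real.pi ≤ pruferAngle p q μ β T) : pruferRadius p q μ α T = 1 := by
  have key : 1 - pruferRadius p q μ α T ^ 2 = 0 := by
    refine eq_zero_of_mul_cos_sub_mul_sin_nonneg (b := pruferRadius p q μ α T *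
      pruferRadius p q μ (α + Real.pi / 2) T *
      Real.cos (pruferAngle p q μ (α + Real.pi / 2) T - pruferAngle p q μ α T)) fun s hs => ?_
    have hsin := Real.sin_pos_of_pos_of_lt_pi hs.1 hs.2
    refine nonneg_of_mul_nonneg_right ?_ hsin
    rw [← hc.mul_sin_pruferAngle_sub μ α s T, h]
    refine mul_nonneg (mul_pos (pruferRadius_pos ..) (pruferRadius_pos ..)).le
      (Real.sin_nonneg_of_nonneg_of_le_pi ?_ ?_)
    · linarith [hle (α + s)]
    · linarith [(abs_lt.1 (hc.abs_pruferAngle_sub_lt hT h (α + s))).2]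
  exact (pow_eq_one_iff_of_nonneg (pruferRadius_pos p q μ α T).le two_ne_zero).1 (by linarith)

theorem radius_eq_one_of_ge {T : ℝ} (hT : 0 ≤ T) {μ α : ℝ} {m : ℤ}
    (h : pruferAngle p q μ α T = α + m * Real.pi)
    (hge : ∀ β, pruferAngle p q μ β T ≤ β + m * Real.pi) : pruferRadius p q μ α T = 1 := by
  have key : -(1 - pruferRadius p q μ α T ^ 2) = 0 := by
    refine eq_zero_of_mul_cos_sub_mul_sin_nonneg (b := -(pruferRadius p q μ α T *
      pruferRadius p q μ (α + Real.pi / 2) T *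
      Real.cos (pruferAngle p q μ (α + Real.pi / 2) T - pruferAngle p q μ α T))) fun s hs => ?_
    have hsin := Real.sin_pos_of_pos_of_lt_pi hs.1 hs.2
    refine nonneg_of_mul_nonneg_right ?_ hsin
    have heq := hc.mul_sin_pruferAngle_sub μ α s T
    have hnonpos : pruferRadius p q μ α T * pruferRadius p q μ (α + s) T *
        Real.sin (pruferAngle p q μ (α + s) T - (pruferAngle p q μ α T + s)) ≤ 0 := by
      rw [h]
      refine mul_nonpos_of_nonneg_of_nonpos
        (mul_pos (pruferRadius_pos ..) (pruferRadius_pos ..)).le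
        (Real.sin_nonpos_of_nonpos_of_neg_pi_le ?_ ?_)
      · linarith [hge (α + s)]
      · linarith [(abs_lt.1 (hc.abs_pruferAngle_sub_lt hT h (α + s))).1]
    rw [heq] at hnonpos
    linarith
  exact (pow_eq_one_iff_of_nonneg (pruferRadius_pos p q μ α T).le two_ne_zero).1 (by linarith)

/-- If one solution makes an exact turn, the others all turn at least, or all at most, as far. -/
theorem forall_le_or_forall_ge_of_isTurn {T : ℝ} (hT : 0 ≤ T) {μ α : ℝ} {m : ℤ}
    (h : IsTurn p q T μ α m) :
    (∀ β, β + m * Real.pi ≤ pruferAngle p q μ β T) ∨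
      ∀ β, pruferAngle p q μ β T ≤ β + m * Real.pi := by
  -- With radius 1 at α the cosine term of the comparison formula drops out. What remains is a
  -- constant times sin² (β - α), whose sign does not change with β.
  have key : ∀ β, pruferRadius p q μ β T *
      Real.sin (pruferAngle p q μ β T - (β + m * Real.pi)) =
      -(pruferRadius p q μ (α + Real.pi / 2) T *
        Real.cos (pruferAngle p q μ (α + Real.pi / 2) T - pruferAngle p q μ α T)) *
        Real.sin (β - α) ^ 2 := by
    intro β
    have := hc.mul_sin_pruferAngle_sub μ α (β - α) T
    rw [add_sub_cancel, h.1, one_mul, one_mul] at this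
    rw [← sub_add_cancel (β + m * Real.pi) (α + m * Real.pi),
      show β + m * Real.pi - (α + m * Real.pi) + (α + m * Real.pi) =
        α + m * Real.pi + (β - α) by ring, ← h.2, this]
    ring
  rcases le_total (pruferRadius p q μ (α + Real.pi / 2) T *
    Real.cos (pruferAngle p q μ (α + Real.pi / 2) T - pruferAngle p q μ α T)) 0 with hb | hb
  · refine Or.inl fun β => ?_
    by_contra hlt
    have hneg := Real.sin_neg_of_neg_of_neg_pi_lt
      (show pruferAngle p q μ β T - (β + m * Real.pi) < 0 by linarith)
      (abs_lt.1 (hc.abs_pruferAngle_sub_lt hT h.2 β)).1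
    have := mul_neg_of_pos_of_neg (pruferRadius_pos p q μ β T) hneg
    rw [key β] at this
    exact absurd this (not_lt.2 (mul_nonneg (neg_nonneg.2 hb) (sq_nonneg _)))
  · refine Or.inr fun β => ?_
    by_contra hlt
    have hpos := Real.sin_pos_of_pos_of_lt_pi
      (show 0 < pruferAngle p q μ β T - (β + m * Real.pi) by linarith)
      (abs_lt.1 (hc.abs_pruferAngle_sub_lt hT h.2 β)).2
    have := mul_pos (pruferRadius_pos p q μ β T) hpos
    rw [key β] at this
    exact absurd this (not_lt.2 (mul_nonpos_of_nonpos_of_nonneg (neg_nonpos.2 hb) (sq_nonneg _)))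

/-- If two independent solutions make the same exact turn, then so do all. -/
theorem pruferAngle_eq_of_isTurn_of_isTurn {T : ℝ} (hT : 0 ≤ T) {μ α γ : ℝ} {m : ℤ}
    (h : IsTurn p q T μ α m) (h' : IsTurn p q T μ γ m) (hne : Real.sin (γ - α) ≠ 0) (β : ℝ) :
    pruferAngle p q μ β T = β + m * Real.pi := by
  have hγ := hc.mul_sin_pruferAngle_sub μ α (γ - α) T
  rw [add_sub_cancel, h.1, h'.1, h.2, h'.2] at hγ
  rw [show γ + m * Real.pi - (α + m * Real.pi + (γ - α)) = 0 by ring, Real.sin_zero, ← h.2] at hγ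
  have hb : pruferRadius p q μ (α + Real.pi / 2) T *
      Real.cos (pruferAngle p q μ (α + Real.pi / 2) T - pruferAngle p q μ α T) = 0 := by
    have h0 : Real.sin (γ - α) ^ 2 * (pruferRadius p q μ (α + Real.pi / 2) T *
      Real.cos (pruferAngle p q μ (α + Real.pi / 2) T - pruferAngle p q μ α T)) = 0 := by
      linarith
    exact (mul_eq_zero.1 h0).resolve_left (pow_ne_zero 2 hne)
  have hβ := hc.mul_sin_pruferAngle_sub μ α (β - α) T
  rw [add_sub_cancel, h.1, one_mul, one_mul, hb, h.2,
    show α + m * Real.pi + (β - α) = β + m * Real.pi by ring] at hβ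
  have hlt := abs_lt.1 (hc.abs_pruferAngle_sub_lt hT h.2 β)
  have hsin : Real.sin (pruferAngle p q μ β T - (β + m * Real.pi)) = 0 :=
    (mul_eq_zero.1 (hβ.trans (by ring))).resolve_left (pruferRadius_pos p q μ β T).ne'
  exact sub_eq_zero.1 ((Real.sin_eq_zero_iff_of_lt_of_lt hlt.1 hlt.2).1 hsin)

end Turn

end SLCoefficients

/-! ### Eigenvalues with prescribed extremal turn -/

/-- The largest turn over all initial angles is exactly `m` half-turns. -/
def IsMaxTurn (p q : ℝ → ℝ) (T μ : ℝ) (m : ℤ) : Prop :=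
  (∀ β, pruferAngle p q μ β T ≤ β + m * Real.pi) ∧
    ∃ α, pruferAngle p q μ α T = α + m * Real.pi

/-- The smallest turn over all initial angles is exactly `m` half-turns. -/
def IsMinTurn (p q : ℝ → ℝ) (T μ : ℝ) (m : ℤ) : Prop :=
  (∀ β, β + m * Real.pi ≤ pruferAngle p q μ β T) ∧
    ∃ α, pruferAngle p q μ α T = α + m * Real.pi

/-- The functions which are multiplied by `s` under translation by `τ`. -/
def translationEigenspace (τ s : ℝ) : Submodule ℝ (ℝ → ℝ) where
  carrier := {v | ∀ t, v (t + τ) = s * v t}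
  zero_mem' := fun t => by simp
  add_mem' := fun {u v} hu hv t => by rw [Pi.add_apply, hu, hv, Pi.add_apply, mul_add]
  smul_mem' := fun c u hu t => by
    rw [Pi.smul_apply, hu, Pi.smul_apply, smul_eq_mul, smul_eq_mul]; ring

theorem mem_translationEigenspace {τ s : ℝ} {v : ℝ → ℝ} :
    v ∈ translationEigenspace τ s ↔ ∀ t, v (t + τ) = s * v t := Iff.rfl

theorem mem_translationEigenspace_one {τ : ℝ} {v : ℝ → ℝ} :
    v ∈ translationEigenspace τ 1 ↔ Function.Periodic v τ := by
  simp [mem_translationEigenspace, Function.Periodic]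

theorem mem_translationEigenspace_neg_one {τ : ℝ} {v : ℝ → ℝ} :
    v ∈ translationEigenspace τ (-1) ↔ Function.Antiperiodic v τ := by
  simp [mem_translationEigenspace, Function.Antiperiodic]

theorem mem_translationEigenspace_nat_mul {τ s : ℝ} {v : ℝ → ℝ}
    (h : v ∈ translationEigenspace τ s) (n : ℕ) : v ∈ translationEigenspace (n * τ) (s ^ n) := by
  induction n with
  | zero => intro t; simp
  | succ n ih =>
    intro t
    have : t + (n + 1 : ℕ) * τ = (t + n * τ) + τ := by push_cast; ring
    rw [this, h, ih, pow_succ]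
    ring

/-- The supremum over a compact set is continuous in the parameter and attained, so the intermediate
value theorem applies to it. -/
theorem exists_forall_le_and_exists_eq {g : ℝ → ℝ → ℝ} (hg : Continuous (Function.uncurry g))
    {K : Set ℝ} (hK : IsCompact K) {μ₁ μ₂ c : ℝ} (h₁ : ∀ α ∈ K, g μ₁ α ≤ c)
    (h₂ : ∃ α ∈ K, c ≤ g μ₂ α) :
    ∃ μ, (∀ α ∈ K, g μ α ≤ c) ∧ ∃ α ∈ K, g μ α = c := by
  obtain ⟨α₂, hα₂, hc₂⟩ := h₂
  have hne : K.Nonempty := ⟨α₂, hα₂⟩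
  have hcont := hK.continuous_sSup hg
  have hgK : ∀ μ, ContinuousOn (g μ) K := fun μ =>
    (hg.comp (continuous_const.prodMk continuous_id)).continuousOn
  have hle : ∀ μ, ∀ α ∈ K, g μ α ≤ sSup (g μ '' K) := fun μ α hα =>
    le_csSup (hK.bddAbove_image (hgK μ)) (mem_image_of_mem _ hα)
  obtain ⟨μ, hμ⟩ := mem_range_of_exists_le_of_exists_ge hcont (c := c)
    ⟨μ₁, csSup_le (hne.image _) (by rintro _ ⟨α, hα, rfl⟩; exact h₁ α hα)⟩
    ⟨μ₂, hc₂.trans (hle μ₂ α₂ hα₂)⟩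
  refine ⟨μ, fun α hα => (hle μ α hα).trans hμ.le, ?_⟩
  obtain ⟨α, hα, hαeq, -⟩ := hK.exists_sSup_image_eq_and_ge hne (hgK μ)
  exact ⟨α, hα, by rw [← hαeq, ← hμ]⟩

namespace SLCoefficients

variable {p q : ℝ → ℝ} (hc : SLCoefficients p q)
include hc

/-- At a larger eigenvalue, the initial angle attaining the maximum would turn strictly farther. -/
theorem isMaxTurn_unique {T : ℝ} (hT : 0 < T) {μ ν : ℝ} {m : ℤ} (h : IsMaxTurn p q T μ m)
    (h' : IsMaxTurn p q T ν m) : μ = ν := by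
  obtain ⟨⟨h1, α, hα⟩, h1', β, hβ⟩ := And.intro h h'
  rcases lt_trichotomy μ ν with hlt | heq | hgt
  · exact absurd (h1' α) (not_le.2 (hα ▸ hc.pruferAngle_strictMono_eigenvalue α hT hlt))
  · exact heq
  · exact absurd (h1 β) (not_le.2 (hβ ▸ hc.pruferAngle_strictMono_eigenvalue β hT hgt))

theorem isMinTurn_unique {T : ℝ} (hT : 0 < T) {μ ν : ℝ} {m : ℤ} (h : IsMinTurn p q T μ m)
    (h' : IsMinTurn p q T ν m) : μ = ν := by
  obtain ⟨⟨h1, α, hα⟩, h1', β, hβ⟩ := And.intro h h'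
  rcases lt_trichotomy μ ν with hlt | heq | hgt
  · exact absurd (h1 β) (not_le.2 (hβ ▸ hc.pruferAngle_strictMono_eigenvalue β hT hlt))
  · exact heq
  · exact absurd (h1' α) (not_le.2 (hα ▸ hc.pruferAngle_strictMono_eigenvalue α hT hgt))

theorem _root_.IsMaxTurn.exists_isTurn {T μ : ℝ} {m : ℤ} (h : IsMaxTurn p q T μ m)
    (hT : 0 ≤ T) : ∃ α, IsTurn p q T μ α m :=
  let ⟨h1, α, hα⟩ := h
  ⟨α, hc.radius_eq_one_of_ge hT hα h1, hα⟩

theorem _root_.IsMinTurn.exists_isTurn {T μ : ℝ} {m : ℤ} (h : IsMinTurn p q T μ m)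
    (hT : 0 ≤ T) : ∃ α, IsTurn p q T μ α m :=
  let ⟨h1, α, hα⟩ := h
  ⟨α, hc.radius_eq_one_of_le hT hα h1, hα⟩

theorem isMinTurn_or_isMaxTurn {T : ℝ} (hT : 0 ≤ T) {μ α : ℝ} {m : ℤ}
    (h : IsTurn p q T μ α m) : IsMinTurn p q T μ m ∨ IsMaxTurn p q T μ m :=
  (hc.forall_le_or_forall_ge_of_isTurn hT h).imp (fun h1 => ⟨h1, α, h.2⟩) fun h1 => ⟨h1, α, h.2⟩

/-- The number of half-turns of an exact turn increases with the eigenvalue. -/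
theorem isTurn_le_isTurn {T : ℝ} (hT : 0 < T) {μ ν α β : ℝ} {m n : ℤ} (hμν : μ ≤ ν)
    (hm : IsTurn p q T μ α m) (hn : IsTurn p q T ν β n) : m ≤ n := by
  have h1 := (abs_lt.1 (hc.abs_pruferAngle_sub_lt hT.le hm.2 β)).1
  have h2 := (hc.pruferAngle_strictMono_eigenvalue β hT).monotone hμν
  simp only [hn.2] at h2
  have h3 : ((m - 1 : ℤ) : ℝ) * Real.pi < n * Real.pi := by push_cast; linarith
  have h4 : m - 1 < n := by exact_mod_cast lt_of_mul_lt_mul_right h3 Real.pi_pos.le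
  omega

theorem isTurn_unique {T : ℝ} (hT : 0 < T) {μ α β : ℝ} {m n : ℤ}
    (hm : IsTurn p q T μ α m) (hn : IsTurn p q T μ β n) : m = n :=
  le_antisymm (hc.isTurn_le_isTurn hT le_rfl hm hn) (hc.isTurn_le_isTurn hT le_rfl hn hm)

theorem isTurn_nonneg {T : ℝ} (hT : 0 < T) {μ α : ℝ} {m : ℤ} (h : IsTurn p q T μ α m) :
    0 ≤ m := by
  have h1 := (abs_lt.1 (hc.abs_pruferAngle_sub_lt hT.le h.2 0)).2
  have h2 := hc.pruferAngle_zero_pos μ hT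
  have h3 : ((-1 : ℤ) : ℝ) * Real.pi < m * Real.pi := by push_cast; linarith
  have h4 : -1 < m := by exact_mod_cast lt_of_mul_lt_mul_right h3 Real.pi_pos.le
  omega

/-- The angle starting at 0 becomes positive. This is why winding number 0 is taken by one index
instead of two. -/
theorem not_isMaxTurn_zero {T : ℝ} (hT : 0 < T) (μ : ℝ) : ¬ IsMaxTurn p q T μ 0 := fun h =>
  absurd (h.1 0) (not_le.2 (by simpa using hc.pruferAngle_zero_pos μ hT))

/-- The turn is π-periodic in the initial angle, so extrema may be sought on a compact interval. -/
theorem forall_turn_of_forall_mem_Icc {T : ℝ} {μ : ℝ} {P : ℝ → Prop}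
    (h : ∀ β ∈ Icc 0 Real.pi, P (pruferAngle p q μ β T - β)) (β : ℝ) :
    P (pruferAngle p q μ β T - β) := by
  obtain ⟨j, ⟨hj1, hj2⟩, -⟩ := existsUnique_sub_zsmul_mem_Ico Real.pi_pos β 0
  rw [zsmul_eq_mul] at hj1 hj2
  have := h (β - j * Real.pi) ⟨hj1, by linarith⟩
  have h2 := hc.pruferAngle_add_int_mul_pi μ (β - j * Real.pi) j T
  rw [sub_add_cancel] at h2
  rwa [h2, show pruferAngle p q μ (β - j * Real.pi) T + j * Real.pi - β =
    pruferAngle p q μ (β - j * Real.pi) T - (β - j * Real.pi) by ring]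

theorem continuous_turn {T : ℝ} (hT : 0 ≤ T) :
    Continuous (Function.uncurry fun μ α => pruferAngle p q μ α T - α) :=
  (hc.continuous_pruferAngle_initial hT).sub continuous_snd

section Existence

variable {T : ℝ} (hT : 0 < T) (hq : Function.Periodic q T)
include hT hq

theorem exists_pruferAngle_le : ∃ μ, pruferAngle p q μ (Real.pi / 2) T ≤ Real.pi / 2 := by
  obtain ⟨μ, hμ⟩ := (hq.compact_of_continuous hT.ne' hc.continuous_q).bddBelow
  exact ⟨μ, hc.pruferAngle_pi_div_two_le (fun t => hμ (mem_range_self t)) hT.le⟩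

/-- For μ below the minimum of q the angle π / 2 does not increase over time T, so by monotonicity
no turn exceeds π ≤ mπ. At ν some turn is nπ ≥ mπ. The maximal turn therefore equals mπ in between.
-/
theorem exists_isMaxTurn {m n : ℤ} (hm : 1 ≤ m) (hmn : m ≤ n) {ν α : ℝ}
    (h : IsTurn p q T ν α n) : ∃ μ, IsMaxTurn p q T μ m := by
  obtain ⟨μ₁, hμ₁⟩ := hc.exists_pruferAngle_le hT hq
  have hm' : (1 : ℝ) ≤ m := by exact_mod_cast hm
  have hmn' : (m : ℝ) ≤ n := by exact_mod_cast hmn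
  have hpi := Real.pi_pos
  have hmpi : Real.pi ≤ m * Real.pi := le_mul_of_one_le_left hpi.le hm'
  obtain ⟨μ, hle, α, hα, heq⟩ := exists_forall_le_and_exists_eq (hc.continuous_turn hT.le)
    (isCompact_Icc (a := 0) (b := Real.pi)) (μ₁ := μ₁) (μ₂ := ν) (c := m * Real.pi)
    (by
      refine fun β _ => hc.forall_turn_of_forall_mem_Icc (P := (· ≤ m * Real.pi)) ?_ β
      refine fun β hβ => ?_
      rcases le_total β (Real.pi / 2) with hβ' | hβ'
      · have := (hc.pruferAngle_strictMono μ₁ hT.le).monotone hβ'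
        linarith [hβ.1]
      · have := (hc.pruferAngle_strictMono μ₁ hT.le).monotone
          (show β ≤ Real.pi / 2 + (1 : ℤ) * Real.pi by push_cast; linarith [hβ.2])
        simp only [hc.pruferAngle_add_int_mul_pi] at this
        push_cast at this
        linarith [hβ.1])
    (by
      by_contra! hlt
      have := hc.forall_turn_of_forall_mem_Icc (P := (· < m * Real.pi)) hlt α
      simp only [h.2] at this
      have := mul_le_mul_of_nonneg_right hmn' hpi.le
      linarith)
  refine ⟨μ, fun β => ?_, α, by linarith⟩
  have := hc.forall_turn_of_forall_mem_Icc (P := (· ≤ m * Real.pi)) hle β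
  linarith

/-- At ν every turn exceeds (n - 1)π ≥ mπ, while for small μ the angle π / 2 has turn at most 0 ≤
mπ. The intermediate value argument is applied to the negated turn, which converts the minimum into
a maximum. -/
theorem exists_isMinTurn {m n : ℤ} (hm : 0 ≤ m) (hmn : m < n) {ν α : ℝ}
    (h : IsTurn p q T ν α n) : ∃ μ, IsMinTurn p q T μ m := by
  obtain ⟨μ₂, hμ₂⟩ := hc.exists_pruferAngle_le hT hq
  have hm' : (0 : ℝ) ≤ m := by exact_mod_cast hm
  have hmn' : (m : ℝ) + 1 ≤ n := by exact_mod_cast hmn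
  have hpi := Real.pi_pos
  have hmpi : 0 ≤ m * Real.pi := mul_nonneg hm' hpi.le
  obtain ⟨μ, hle, α, hα, heq⟩ := exists_forall_le_and_exists_eq
    (g := fun μ α => -(pruferAngle p q μ α T - α)) (hc.continuous_turn hT.le).neg
    (isCompact_Icc (a := 0) (b := Real.pi)) (μ₁ := ν) (μ₂ := μ₂) (c := -(m * Real.pi))
    (by
      refine fun β _ => ?_
      have h1 := (abs_lt.1 (hc.abs_pruferAngle_sub_lt hT.le h.2 β)).1
      have := mul_le_mul_of_nonneg_right hmn' hpi.le
      linarith)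
    ⟨Real.pi / 2, ⟨by linarith, by linarith⟩, by linarith⟩
  refine ⟨μ, fun β => ?_, α, by linarith⟩
  have := hc.forall_turn_of_forall_mem_Icc (P := fun x => -x ≤ -(m * Real.pi)) hle β
  linarith

end Existence

end SLCoefficients

/-! ### Multiplicities and counting of indices -/

theorem LinearIndependent.ncard_eq_of_span_image_eq {ι V : Type*} [AddCommGroup V] [Module ℝ V]
    {h : ι → V} (hh : LinearIndependent ℝ h) {S : Set ι} {n : ℕ} {b : Fin n → V}
    (hb : LinearIndependent ℝ b)
    (hspan : Submodule.span ℝ (h '' S) = Submodule.span ℝ (range b)) : S.ncard = n := by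
  have h1 := rank_span_set (hh.linearIndepOn (s := S)).id_image
  have h2 := finrank_span_eq_card hb
  rw [← hspan, Module.finrank, h1, Fintype.card_fin] at h2
  rw [← ncard_image_of_injective S hh.injective, ← Nat.card_coe_set_eq, Nat.card, h2]

theorem exists_eq_Iio_of_isLowerSet {s : Set ℕ} (hs : IsLowerSet s) (hfin : s.Finite) :
    ∃ n, s = Iio n := by
  classical
  have hex : ∃ n, n ∉ s := hfin.exists_notMem
  refine ⟨Nat.find hex, Set.ext fun i => ⟨fun hi => ?_, fun hi => ?_⟩⟩
  · by_contra hle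
    exact Nat.find_spec hex (hs (not_lt.1 hle) hi)
  · exact not_not.1 (Nat.find_min hex hi)

/-- A monotone sequence which takes the value `0` once and each other value twice. -/
theorem eq_add_one_div_two_of_monotone {w : ℕ → ℕ} (hw : Monotone w)
    (h0 : {i | w i = 0}.ncard = 1) (hpos : ∀ k, 1 ≤ k → {i | w i = k}.ncard = 2) (i : ℕ) :
    w i = (i + 1) / 2 := by
  have hfib : ∀ k, {i | w i = k}.Finite := fun k => by
    refine finite_of_ncard_pos ?_
    rcases Nat.eq_zero_or_pos k with rfl | hk
    · rw [h0]; exact one_pos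
    · rw [hpos k hk]; exact two_pos
  have hsucc : ∀ k, {i | w i ≤ k + 1} = {i | w i ≤ k} ∪ {i | w i = k + 1} := fun k => by
    ext i
    simp only [mem_ofPred_eq, mem_union]
    omega
  have hcard : ∀ k, {i | w i ≤ k}.Finite ∧ {i | w i ≤ k}.ncard = 2 * k + 1 := by
    intro k
    induction k with
    | zero => simpa only [Nat.le_zero] using And.intro (hfib 0) h0
    | succ k ih =>
      rw [hsucc]
      refine ⟨ih.1.union (hfib _), ?_⟩
      rw [ncard_union_eq _ ih.1 (hfib _), ih.2, hpos _ (by omega)]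
      · omega
      · refine disjoint_left.2 fun i hi hi' => ?_
        simp only [mem_ofPred_eq] at hi hi'
        omega
  -- By monotonicity the sublevel set is an initial segment, so its cardinality 2k + 1 determines
  -- it.
  have hiff : ∀ k i, w i ≤ k ↔ i < 2 * k + 1 := by
    intro k i
    obtain ⟨n, hn⟩ := exists_eq_Iio_of_isLowerSet
      (s := {i | w i ≤ k}) (fun a b hab ha => (hw hab).trans ha) (hcard k).1
    have hk := (hcard k).2
    rw [hn, ncard_eq_toFinset_card', toFinset_Iio, Nat.card_Iio] at hk
    rw [← hk]
    exact Set.ext_iff.1 hn i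
  have h1 := (hiff (w i) i).1 le_rfl
  have h2 := hiff (w i - 1) i
  omega

/-! ### Winding numbers of the enumerated eigenfunctions -/

namespace IsPeriodicSLEnumeration

variable {p q : ℝ → ℝ} {T : ℝ} {lam : ℕ → ℝ} {h : ℕ → ℝ → ℝ}
  (henum : IsPeriodicSLEnumeration p q T lam h) (hc : SLCoefficients p q)
include henum hc

omit hc in
theorem span_eq (μ : ℝ) : Submodule.span ℝ (h '' {i | lam i = μ}) =
    slSolutionSpace p q μ ⊓ translationEigenspace T 1 := by
  refine le_antisymm (Submodule.span_le.2 ?_) ?_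
  · rintro _ ⟨i, rfl, rfl⟩
    exact ⟨henum.solution i, mem_translationEigenspace_one.2 (henum.periodic i)⟩
  · rintro v ⟨hv, hv'⟩
    exact henum.complete μ v hv (mem_translationEigenspace_one.1 hv')

section Multiplicity

variable (hT : 0 < T) (hp : Function.Periodic p T) (hq : Function.Periodic q T)
include hT hp

omit henum hT in
/-- A nonzero periodic solution makes a whole number of full turns. -/
theorem _root_.SLCoefficients.exists_isTurn_of_periodic {μ : ℝ} {v : ℝ → ℝ}
    (hv : SLSolution p q μ v) (hv' : Function.Periodic v T) (hne : v ≠ 0) :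
    ∃ (c α : ℝ) (k : ℤ), v = c • pruferSolution p q μ α ∧ c ≠ 0 ∧ IsTurn p q T μ α (2 * k) := by
  obtain ⟨c, α, rfl⟩ := hc.exists_eq_smul_pruferSolution hv
  have hc0 : c ≠ 0 := by
    rintro rfl
    exact hne (zero_smul _ _)
  obtain ⟨k, hk⟩ := hc.exists_isTurn_of_add_time hp (μ := μ) (α := α) (m := 0) fun t => by
    have := hv' t
    simp only [Pi.smul_apply, smul_eq_mul] at this
    rw [zpow_zero, one_mul]
    exact mul_left_cancel₀ hc0 this
  exact ⟨c, α, k, rfl, hc0, by simpa using hk⟩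

include hq

-- Every solution is periodic here, so the eigenspace is the whole two-dimensional solution space.
omit hT in
theorem ncard_eq_two {μ : ℝ} {k : ℤ} (hall : ∀ α, IsTurn p q T μ α (2 * k)) :
    {i | lam i = μ}.ncard = 2 := by
  have hli : LinearIndependent ℝ
      ![pruferSolution p q μ 0, pruferSolution p q μ (0 + Real.pi / 2)] := by
    refine LinearIndependent.pair_iff.2 fun s t hst => ?_
    have ht : t = 0 := by
      have := congrFun hst 0
      simpa [hc.pruferSolution_zero] using this
    rw [ht, zero_smul, add_zero] at hst
    exact ⟨(smul_eq_zero.1 hst).resolve_right (hc.pruferSolution_ne_zero μ 0), ht⟩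
  refine henum.linearIndependent.ncard_eq_of_span_image_eq hli ?_
  rw [henum.span_eq]
  refine le_antisymm ?_ (Submodule.span_le.2 ?_)
  · rintro v ⟨hv, -⟩
    obtain ⟨c, α, rfl⟩ := hc.exists_eq_smul_pruferSolution hv
    refine Submodule.smul_mem _ c ?_
    have hα := hc.pruferSolution_add_angle μ 0 α
    rw [zero_add α] at hα
    rw [hα]
    exact add_mem (Submodule.smul_mem _ _ (Submodule.subset_span ⟨1, rfl⟩))
      (Submodule.smul_mem _ _ (Submodule.subset_span ⟨0, rfl⟩))
  · have hmem : ∀ α, pruferSolution p q μ α ∈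
        slSolutionSpace p q μ ⊓ translationEigenspace T 1 := fun α =>
      ⟨hc.slSolution_pruferSolution μ α, fun t => by
        rw [hc.pruferSolution_add_time_of_isTurn hp hq (hall α), zpow_mul]
        simp⟩
    rintro _ ⟨j, rfl⟩
    fin_cases j
    · exact hmem _
    · exact hmem _

/-- A second independent periodic solution would make the same exact turn, and then every initial
angle would, by `pruferAngle_eq_of_isTurn_of_isTurn`. -/
theorem ncard_eq_one {μ α : ℝ} {k : ℤ} (hα : IsTurn p q T μ α (2 * k))
    (hne : ∃ β, pruferAngle p q μ β T ≠ β + (2 * k : ℤ) * Real.pi) :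
    {i | lam i = μ}.ncard = 1 := by
  have hli : LinearIndependent ℝ ![pruferSolution p q μ α] := by
    rw [linearIndependent_unique_iff]
    exact hc.pruferSolution_ne_zero μ α
  refine henum.linearIndependent.ncard_eq_of_span_image_eq hli ?_
  rw [henum.span_eq]
  refine le_antisymm ?_ (Submodule.span_le.2 ?_)
  · rintro v ⟨hv, hv'⟩
    by_cases hv0 : v = 0
    · rw [hv0]; exact Submodule.zero_mem _
    obtain ⟨c, γ, j, rfl, -, hj⟩ := hc.exists_isTurn_of_periodic hp hv
      (mem_translationEigenspace_one.1 hv') hv0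
    refine Submodule.smul_mem _ c ?_
    rw [hc.isTurn_unique hT hj hα] at hj
    have hsin : Real.sin (γ - α) = 0 := by
      by_contra hsin
      obtain ⟨β, hβ⟩ := hne
      exact hβ (hc.pruferAngle_eq_of_isTurn_of_isTurn hT.le hα hj hsin β)
    rw [← add_sub_cancel α γ, hc.pruferSolution_add_angle, hsin, zero_smul, zero_add]
    exact Submodule.smul_mem _ _ (Submodule.subset_span ⟨0, rfl⟩)
  · rintro _ ⟨j, rfl⟩
    fin_cases j
    refine ⟨hc.slSolution_pruferSolution μ α, fun t => ?_⟩
    have := hc.pruferSolution_add_time_of_isTurn hp hq hα t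
    rw [zpow_mul] at this
    simpa using this

theorem finite_eigenvalue_eq {μ α : ℝ} {k : ℤ} (hα : IsTurn p q T μ α (2 * k)) :
    {i | lam i = μ}.Finite := by
  by_cases hall : ∀ β, pruferAngle p q μ β T = β + (2 * k : ℤ) * Real.pi
  · refine finite_of_ncard_pos ?_
    rw [henum.ncard_eq_two hc hp hq (k := k) fun β =>
      ⟨hc.radius_eq_one_of_le hT.le (hall β) fun γ => (hall γ).ge, hall β⟩]
    exact two_pos
  · refine finite_of_ncard_pos ?_
    push Not at hall
    rw [henum.ncard_eq_one hc hT hp hq hα hall]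
    exact one_pos

end Multiplicity

section Winding

variable (hT : 0 < T) (hp : Function.Periodic p T) (hq : Function.Periodic q T)
include hT hp

theorem exists_winding (i : ℕ) : ∃ (c α : ℝ) (k : ℕ),
    h i = c • pruferSolution p q (lam i) α ∧ c ≠ 0 ∧
      IsTurn p q T (lam i) α (2 * (k : ℤ)) := by
  obtain ⟨c, α, k, h1, h2, h3⟩ := hc.exists_isTurn_of_periodic hp (henum.solution i)
    (henum.periodic i) (henum.linearIndependent.ne_zero i)
  have hk := hc.isTurn_nonneg hT h3
  lift k to ℕ using by omega
  exact ⟨c, α, k, h1, h2, h3⟩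

include hq

/-- The winding number is monotone in the index. Its fibre over k is the union of the eigenspace
indices for the minimal-turn and the maximal-turn eigenvalue, which makes one index for k = 0 and
two for each k ≥ 1. -/
theorem winding_eq {w : ℕ → ℕ} (hw : ∀ i, ∃ α, IsTurn p q T (lam i) α (2 * (w i : ℤ)))
    (i : ℕ) : w i = (i + 1) / 2 := by
  have hmono : Monotone w := fun i j hij => by
    obtain ⟨α, hα⟩ := hw i
    obtain ⟨β, hβ⟩ := hw j
    have := hc.isTurn_le_isTurn hT (henum.monotone hij) hα hβ
    omega
  have heq : ∀ {i : ℕ} {α : ℝ} {k : ℕ}, IsTurn p q T (lam i) α (2 * (k : ℤ)) → w i = k := by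
    intro i α k hk
    obtain ⟨β, hβ⟩ := hw i
    have := hc.isTurn_unique hT hβ hk
    omega
  have hminmax : ∀ k : ℕ, {i | w i = k} =
      {i | IsMinTurn p q T (lam i) (2 * (k : ℤ))} ∪
        {i | IsMaxTurn p q T (lam i) (2 * (k : ℤ))} := by
    intro k
    ext i
    constructor
    · rintro rfl
      obtain ⟨α, hα⟩ := hw i
      exact hc.isMinTurn_or_isMaxTurn hT.le hα
    · rintro (hi | hi)
      · exact heq (hi.exists_isTurn hc hT.le).choose_spec
      · exact heq (hi.exists_isTurn hc hT.le).choose_spec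
  have hmin : ∀ {μ : ℝ} {k : ℕ}, IsMinTurn p q T μ (2 * (k : ℤ)) →
      {i | IsMinTurn p q T (lam i) (2 * (k : ℤ))} = {i | lam i = μ} := fun hμ =>
    Set.ext fun i => ⟨fun hi => hc.isMinTurn_unique hT hi hμ, fun hi => by
      rw [mem_ofPred_eq] at hi ⊢; rwa [hi]⟩
  have hmax : ∀ {μ : ℝ} {k : ℕ}, IsMaxTurn p q T μ (2 * (k : ℤ)) →
      {i | IsMaxTurn p q T (lam i) (2 * (k : ℤ))} = {i | lam i = μ} := fun hμ =>
    Set.ext fun i => ⟨fun hi => hc.isMaxTurn_unique hT hi hμ, fun hi => by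
      rw [mem_ofPred_eq] at hi ⊢; rwa [hi]⟩
  have hfin : ∀ k : ℕ, {i | w i = k}.Finite := by
    intro k
    rw [hminmax]
    refine Finite.union ?_ ?_
    · rcases eq_empty_or_nonempty {i | IsMinTurn p q T (lam i) (2 * (k : ℤ))} with h0 | ⟨i, hi⟩
      · rw [h0]; exact finite_empty
      · rw [hmin hi]
        exact henum.finite_eigenvalue_eq hc hT hp hq (hi.exists_isTurn hc hT.le).choose_spec
    · rcases eq_empty_or_nonempty {i | IsMaxTurn p q T (lam i) (2 * (k : ℤ))} with h0 | ⟨i, hi⟩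
      · rw [h0]; exact finite_empty
      · rw [hmax hi]
        exact henum.finite_eigenvalue_eq hc hT hp hq (hi.exists_isTurn hc hT.le).choose_spec
  -- The enumeration has infinitely many indices and the fibres are finite. Arbitrarily large
  -- winding numbers therefore occur, and they supply the upper end for the intermediate value
  -- arguments.
  have hunbdd : ∀ k : ℕ, ∃ i, k < w i := by
    intro k
    by_contra! hle
    refine infinite_univ (α := ℕ) (((finite_Iic k).biUnion fun j _ => hfin j).subset fun i _ => ?_)
    exact mem_biUnion (mem_Iic.2 (hle i)) rfl
  refine eq_add_one_div_two_of_monotone hmono ?_ (fun k hk => ?_) i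
  · obtain ⟨i, hi⟩ := hunbdd 0
    obtain ⟨α, hα⟩ := hw i
    obtain ⟨μ, hμ⟩ := hc.exists_isMinTurn hT hq (m := 2 * ((0 : ℕ) : ℤ)) (by omega) (by omega) hα
    have hempty : {i | IsMaxTurn p q T (lam i) (2 * ((0 : ℕ) : ℤ))} = ∅ :=
      eq_empty_of_forall_notMem fun i hi => hc.not_isMaxTurn_zero hT _ (by simpa using hi)
    rw [hminmax, hempty, union_empty, hmin hμ]
    refine henum.ncard_eq_one hc hT hp hq (hμ.exists_isTurn hc hT.le).choose_spec ⟨0, ?_⟩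
    simpa using (hc.pruferAngle_zero_pos μ hT).ne'
  · obtain ⟨i, hi⟩ := hunbdd k
    obtain ⟨α, hα⟩ := hw i
    obtain ⟨μ, hμ⟩ := hc.exists_isMinTurn hT hq (m := 2 * (k : ℤ)) (by omega) (by omega) hα
    obtain ⟨ν, hν⟩ := hc.exists_isMaxTurn hT hq (m := 2 * (k : ℤ)) (by omega) (by omega) hα
    rw [hminmax, hmin hμ, hmax hν]
    by_cases hμν : μ = ν
    · subst hμν
      have hall : ∀ β, pruferAngle p q μ β T = β + (2 * (k : ℤ) : ℤ) * Real.pi := fun β =>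
        le_antisymm (hν.1 β) (hμ.1 β)
      rw [union_self]
      exact henum.ncard_eq_two hc hp hq (k := k) fun β =>
        ⟨hc.radius_eq_one_of_le hT.le (hall β) hμ.1, hall β⟩
    · obtain ⟨β, hβ⟩ := hμ.exists_isTurn hc hT.le
      obtain ⟨γ, hγ⟩ := hν.exists_isTurn hc hT.le
      rw [ncard_union_eq _ (henum.finite_eigenvalue_eq hc hT hp hq hβ)
        (henum.finite_eigenvalue_eq hc hT hp hq hγ), henum.ncard_eq_one hc hT hp hq hβ,
        henum.ncard_eq_one hc hT hp hq hγ]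
      -- If every angle made the exact turn at one of the two eigenvalues, that eigenvalue would be
      -- extremal in both senses and so equal to the other.
      · by_contra! hall
        exact hμν (hc.isMinTurn_unique hT hμ ⟨fun β => (hall β).ge, 0, hall 0⟩)
      · by_contra! hall
        exact hμν (hc.isMaxTurn_unique hT ⟨fun β => (hall β).le, 0, hall 0⟩ hν)
      · refine disjoint_left.2 fun i hi hi' => hμν ?_
        rw [mem_ofPred_eq] at hi hi'
        rw [← hi, hi']

end Winding

/-! ### Translation by a fraction of the period -/

section Translation

variable {τ : ℝ} {N : ℕ} (hτ : 0 < τ) (hN : N ≠ 0) (hT : T = N * τ)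
  (hp : Function.Periodic p τ) (hq : Function.Periodic q τ)
include hτ hN hT hp hq

/-- The index of a periodic eigenfunction determines how it behaves under translation by a
fraction of the period. -/
theorem mem_translationEigenspace_iff (m : ℤ) (i : ℕ) :
    h i ∈ translationEigenspace τ ((-1) ^ m) ↔
      ∃ j : ℤ, 2 * (((i + 1) / 2 : ℕ) : ℤ) = N * (2 * j + m) := by
  subst hT
  have hT' : 0 < N * τ := mul_pos (Nat.cast_pos.2 (Nat.pos_of_ne_zero hN)) hτ
  have hex := henum.exists_winding hc hT' (hp.nat_mul N)
  choose c α w hcw using hex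
  rw [← henum.winding_eq hc hT' (hp.nat_mul N) (hq.nat_mul N) (fun i => ⟨α i, (hcw i).2.2⟩) i]
  obtain ⟨heq, hc0, hturn⟩ := hcw i
  have hiff : h i ∈ translationEigenspace τ ((-1) ^ m) ↔
      ∀ t, pruferSolution p q (lam i) (α i) (t + τ) =
        (-1 : ℝ) ^ m * pruferSolution p q (lam i) (α i) t := by
    rw [heq, Submodule.smul_mem_iff _ hc0, mem_translationEigenspace]
  rw [hiff]
  constructor
  · intro hs
    obtain ⟨j, hj⟩ := hc.exists_isTurn_of_add_time hp hs
    exact ⟨j, (hc.isTurn_mul_iff hp hq hτ.le hN hturn).1 hj⟩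
  · rintro ⟨j, hj⟩ t
    rw [hc.pruferSolution_add_time_of_isTurn hp hq
      ((hc.isTurn_mul_iff hp hq hτ.le hN hturn).2 hj), zpow_add₀ (by norm_num), zpow_mul]
    simp

/-- The condition on m makes v periodic with period T. All periodic solutions for μ share one
winding number, so a single nonzero v with the required translation behaviour puts every index with
eigenvalue μ into I, and completeness of the full enumeration suffices. -/
theorem mem_span_iff (m : ℤ) (hm : ((-1 : ℝ) ^ m) ^ N = 1) {I : Set ℕ}
    (hI : ∀ i, h i ∈ translationEigenspace τ ((-1) ^ m) ↔ i ∈ I) (μ : ℝ) (v : ℝ → ℝ) :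
    (SLSolution p q μ v ∧ v ∈ translationEigenspace τ ((-1) ^ m)) ↔
      v ∈ Submodule.span ℝ (h '' {i | lam i = μ ∧ i ∈ I}) := by
  constructor
  · rintro ⟨hv, hv'⟩
    by_cases hv0 : v = 0
    · rw [hv0]; exact Submodule.zero_mem _
    have hT' : 0 < N * τ := mul_pos (Nat.cast_pos.2 (Nat.pos_of_ne_zero hN)) hτ
    have hper : Function.Periodic v (N * τ) := by
      have := mem_translationEigenspace_nat_mul hv' N
      rw [hm] at this
      exact mem_translationEigenspace_one.1 this
    obtain ⟨c, α, k, hvc, hc0, hk⟩ :=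
      hc.exists_isTurn_of_periodic (hp.nat_mul N) hv hper hv0
    have hs : ∀ t, pruferSolution p q μ α (t + τ) =
        (-1 : ℝ) ^ m * pruferSolution p q μ α t := by
      rw [hvc, Submodule.smul_mem_iff _ hc0] at hv'
      exact hv'
    obtain ⟨j, hj⟩ := hc.exists_isTurn_of_add_time hp hs
    have hkj := (hc.isTurn_mul_iff hp hq hτ.le hN hk).1 hj
    have hsub : {i | lam i = μ} ⊆ {i | lam i = μ ∧ i ∈ I} := by
      rintro i rfl
      refine ⟨rfl, (hI i).1 ?_⟩
      rw [henum.mem_translationEigenspace_iff hc hτ hN hT hp hq]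
      subst hT
      have hex := henum.exists_winding hc hT' (hp.nat_mul N)
      choose _ β w hcw using hex
      rw [← henum.winding_eq hc hT' (hp.nat_mul N) (hq.nat_mul N)
        (fun i => ⟨β i, (hcw i).2.2⟩) i]
      exact ⟨j, (hc.isTurn_unique hT' (hcw i).2.2 hk).trans hkj⟩
    exact Submodule.span_mono (image_mono hsub) (henum.complete μ v hv (hT ▸ hper))
  · intro hv
    have hle : Submodule.span ℝ (h '' {i | lam i = μ ∧ i ∈ I}) ≤
        slSolutionSpace p q μ ⊓ translationEigenspace τ ((-1) ^ m) := by
      refine Submodule.span_le.2 ?_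
      rintro _ ⟨i, ⟨rfl, hi⟩, rfl⟩
      exact ⟨henum.solution i, (hI i).2 hi⟩
    exact hle hv

end Translation

end IsPeriodicSLEnumeration

/-! ### Index arithmetic and conclusion -/

theorem mem_antiperiodicIndices_iff {n : ℕ} (hn : 1 ≤ n) (i : ℕ) :
    (∃ j : ℤ, 2 * (((i + 1) / 2 : ℕ) : ℤ) = (2 * n : ℕ) * (2 * j + 1)) ↔
      i ∈ antiperiodicIndices n := by
  -- Winding number k belongs to the indices 2k - 1 and 2k; for k = 0 the first alternative is void.
  have hhalf : ∀ k : ℕ, (i + 1) / 2 = k ↔ i + 1 = 2 * k ∨ i = 2 * k := fun k => by omega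
  constructor
  · rintro ⟨j, hj⟩
    have hj' : (((i + 1) / 2 : ℕ) : ℤ) = n * (2 * j + 1) := by push_cast at hj ⊢; linarith
    have hj0 : 0 ≤ j := by
      have h1 : 0 ≤ (n : ℤ) * (2 * j + 1) := hj' ▸ Int.natCast_nonneg _
      have h2 := nonneg_of_mul_nonneg_right h1 (by omega)
      omega
    lift j to ℕ using hj0
    have hj'' : (i + 1) / 2 = n * (2 * j + 1) := by exact_mod_cast hj'
    exact ⟨j, by rw [mul_assoc]; exact (hhalf _).1 hj''⟩
  · rintro ⟨k, hk⟩
    rw [mul_assoc] at hk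
    refine ⟨k, ?_⟩
    rw [(hhalf _).2 hk]
    push_cast
    ring

theorem mem_periodicIndices_iff {n : ℕ} (hn : 1 ≤ n) (i : ℕ) :
    (∃ j : ℤ, 2 * (((i + 1) / 2 : ℕ) : ℤ) = (n : ℕ) * (2 * j + 0)) ↔
      i ∈ periodicIndices n := by
  have hhalf : ∀ k : ℕ, (i + 1) / 2 = k ↔ i + 1 = 2 * k ∨ i = 2 * k := fun k => by omega
  constructor
  · rintro ⟨j, hj⟩
    have hj' : (((i + 1) / 2 : ℕ) : ℤ) = n * j := by push_cast at hj ⊢; linarith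
    have hj0 : 0 ≤ j := by
      have h1 : 0 ≤ (n : ℤ) * j := hj' ▸ Int.natCast_nonneg _
      exact nonneg_of_mul_nonneg_right h1 (by omega)
    lift j to ℕ using hj0
    have hj'' : (i + 1) / 2 = n * j := by exact_mod_cast hj'
    rcases Nat.eq_zero_or_pos j with rfl | hpos
    · exact Or.inl (by simp at hj''; omega)
    · exact Or.inr ⟨j, hpos, by rw [mul_assoc]; exact (hhalf _).1 hj''⟩
  · rintro (rfl | ⟨k, -, hk⟩)
    · exact ⟨0, by simp⟩
    · rw [mul_assoc] at hk
      refine ⟨k, ?_⟩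
      rw [(hhalf _).2 hk]
      push_cast
      ring

theorem proposition11 (p q : ℝ → ℝ) (T : ℝ) (hT : 0 < T)
    (hp : Continuous p) (hq : Continuous q) (hp_pos : ∀ t, 0 < p t)
    (n : ℕ) (hn : 1 ≤ n) (lam : ℕ → ℝ) (h : ℕ → ℝ → ℝ)
    (henum : IsPeriodicSLEnumeration p q T lam h) :
    (Function.Periodic p (T / (2 * (n : ℝ))) → Function.Periodic q (T / (2 * (n : ℝ))) →
      (∀ i : ℕ, Function.Antiperiodic (h i) (T / (2 * (n : ℝ))) ↔ i ∈ antiperiodicIndices n) ∧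
      ∀ (μ : ℝ) (v : ℝ → ℝ),
        (SLSolution p q μ v ∧ Function.Antiperiodic v (T / (2 * (n : ℝ)))) ↔
          v ∈ Submodule.span ℝ (h '' {i | lam i = μ ∧ i ∈ antiperiodicIndices n})) ∧
    (Function.Periodic p (T / (n : ℝ)) → Function.Periodic q (T / (n : ℝ)) →
      (∀ i : ℕ, Function.Periodic (h i) (T / (n : ℝ)) ↔ i ∈ periodicIndices n) ∧
      ∀ (μ : ℝ) (v : ℝ → ℝ),
        (SLSolution p q μ v ∧ Function.Periodic v (T / (n : ℝ))) ↔
          v ∈ Submodule.span ℝ (h '' {i | lam i = μ ∧ i ∈ periodicIndices n})) := by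
  have hc : SLCoefficients p q := ⟨hp, hq, hp_pos⟩
  have hn0 : (0 : ℝ) < n := by exact_mod_cast hn
  constructor
  · intro hp' hq'
    have hτ : 0 < T / (2 * (n : ℝ)) := by positivity
    have hTτ : T = (2 * n : ℕ) * (T / (2 * (n : ℝ))) := by push_cast; field_simp
    -- Antiperiodicity is the case m = 1 with N = 2n; N is even, so antiperiodic solutions are
    -- T-periodic.
    have hI : ∀ i, h i ∈ translationEigenspace (T / (2 * (n : ℝ))) ((-1) ^ (1 : ℤ)) ↔
        i ∈ antiperiodicIndices n := fun i => by
      rw [henum.mem_translationEigenspace_iff hc hτ (by omega) hTτ hp' hq',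
        mem_antiperiodicIndices_iff hn]
    have hspan := henum.mem_span_iff hc hτ (N := 2 * n) (by omega) hTτ hp' hq' 1 (by simp) hI
    simp only [zpow_one, mem_translationEigenspace_neg_one] at hI hspan
    exact ⟨hI, hspan⟩
  · intro hp' hq'
    have hτ : 0 < T / (n : ℝ) := by positivity
    have hTτ : T = n * (T / (n : ℝ)) := by field_simp
    -- Periodicity is the case m = 0 with N = n.
    have hI : ∀ i, h i ∈ translationEigenspace (T / (n : ℝ)) ((-1) ^ (0 : ℤ)) ↔
        i ∈ periodicIndices n := fun i => by
      rw [henum.mem_translationEigenspace_iff hc hτ (by omega) hTτ hp' hq',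
        mem_periodicIndices_iff hn]
    have hspan := henum.mem_span_iff hc hτ (N := n) (by omega) hTτ hp' hq' 0 (by simp) hI
    simp only [zpow_zero, mem_translationEigenspace_one] at hI hspan
    exact ⟨hI, hspan⟩
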